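/- **Graphs.** Let $n\ge 1$, $s\ge 0$. A graph has vertices $v_1,\dots,v_n$, finitely many internal edges (each having two ends, both assigned to vertices, possibly to the same vertex, and multiple edges being allowed), and $s$ external edges, each having one end assigned to a vertex and one free end, the free ends being labelled by $x_1,\dots,x_s$ bijectively. An isomorphism of two such graphs is a pair of bijections, of the vertices and of the ends of edges, which maps edges to edges, is compatible with the assignment of ends to vertices, and preserves the labels $x_1,\dots,x_s$. The symmetry factor $S^G$ is the order of the group of automorphisms of $G$. Two graphs are regarded as equal if they differ only in the names of their edges and ends of edges, i.e. if there is an isomorphism between them that fixes every vertex $v_1,\dots,v_n$. The cyclomatic number is the dimension over $\mathbb{Z}/2$ of the cycle space, i.e. of the space of sets of internal edges for which every vertex is assigned an even number of their ends. Let $V_{\rm loopless}^{n,k,s}$ be the set of connected graphs without loops that have $n$ vertices $v_1,\dots,v_n$, cyclomatic number $k$ and $s$ external edges with free ends labelled $x_1,\dots,x_s$. For a set $W$, $\mathbb{Q}W$ is the free $\mathbb{Q}$-vector space on $W$. **Linear maps.** For a graph $G$ on $v_1,\dots,v_n$ and $i\ne j$, $l_{i,j}(G)$ is $G$ with one more internal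 edge, connecting $v_i$ and $v_j$. Let $\mathcal{E}_i$ be the set of all ends (of internal and external edges) assigned to $v_i$. Then $s_{\mathcal{E}_i}(G)$ is the sum, over all ordered pairs $(\mathcal{E}_i^{(1)},\mathcal{E}_i^{(2)})$ of disjoint, possibly empty sets with union $\mathcal{E}_i$, of the graphs on $v_1,\dots,v_{n+1}$ obtained from $G$ by adding a new vertex $v_{n+1}$, leaving the ends in $\mathcal{E}_i^{(1)}$ at $v_i$ and reassigning those in $\mathcal{E}_i^{(2)}$ to $v_{n+1}$. Both maps are extended linearly, and for $\rho\ge 1$ $$q_i^{(\rho)}:=\frac{1}{2(\rho-1)!}\;l_{i,n+1}^{\,\rho}\circ s_{\mathcal{E}_i}.$$ **Theorem.** Fix $s\ge 0$. For $n\ge1$ and $k\ge 0$ define linear combinations of graphs $\hat\theta^{n,k,s}$ recursively as follows: $\hat\theta^{1,0,s}$ is the single vertex $v_1$ with $s$ external edges whose free ends are labelled $x_1,\dots,x_s$, with coefficient $1$; $\hat\theta^{1,k,s}:=0$ for $k>0$; and for $n>1$ $$\hat\theta^{n,k,s}:=\frac{1}{k+n-1}\sum_{\rho=1}^{k+1}\sum_{i=1}^{n-1}q_i^{(\rho)}\bigl(\hat\theta^{n-1,k+1-\rho,s}\bigr).$$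 Then, for all $n\ge1$ and $k\ge0$: 1. $\hat\theta^{n,k,s}\in\mathbb{Q}V_{\rm loopless}^{n,k,s}$, i.e. $\hat\theta^{n,k,s}=\sum_{G\in V_{\rm loopless}^{n,k,s}}\alpha_G\,G$ with $\alpha_G\in\mathbb{Q}$; 2. $\alpha_G>0$ for every $G\in V_{\rm loopless}^{n,k,s}$; 3. $\sum_{G\in\mathscr{C}}\alpha_G=1/S^{\mathscr{C}}$ for every isomorphism class $\mathscr{C}\subseteq V_{\rm loopless}^{n,k,s}$, where $S^{\mathscr{C}}$ is the symmetry factor of the graphs in $\mathscr{C}$. -/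

import Mathlib

/-- A graph on the vertices `v_1, …, v_n` (here `Fin n`) with `m` internal edges and `s` external
edges whose free ends carry the distinct labels `x_1, …, x_s`.

The internal edge `j : Fin m` consists of the two ends `(j, 0)` and `(j, 1)`, each of which is
assigned to a vertex.  An external edge is identified with its label `z : Fin s`; one of its ends
is assigned to a vertex, the other one is free.  `att` is the assignment of all the ends that are
not free (`Sum.inl (j, b)` for the ends of internal edges, `Sum.inr z` for the end of the external
edge labelled `z`) to vertices. -/
structure RawGraph (n s : ℕ) where
  m : ℕ
  att : (Fin m × Fin 2) ⊕ Fin s → Fin n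

namespace RawGraph

variable {n s : ℕ}

/-- An isomorphism of graphs: a bijection of the vertices and a bijection of the ends of edges which
maps internal edges to internal edges and is compatible with the assignment of ends to vertices.
Each external edge is mapped to the one with the same label, its free end to the free end; so the
bijection of ends is determined on external edges, and only internal ends are recorded. -/
structure Iso (G H : RawGraph n s) where
  vertexEquiv : Fin n ≃ Fin n
  endEquiv : Fin G.m × Fin 2 ≃ Fin H.m × Fin 2
  edge : ∀ a b, (endEquiv a).1 = (endEquiv b).1 ↔ a.1 = b.1
  att_int : ∀ a, H.att (Sum.inl (endEquiv a)) = vertexEquiv (G.att (Sum.inl a))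
  att_ext : ∀ z, H.att (Sum.inr z) = vertexEquiv (G.att (Sum.inr z))

/-- The symmetry factor: the order of the group of automorphisms (acting on vertices and on ends
of edges). -/
noncomputable def symmetryFactor (G : RawGraph n s) : ℕ := Nat.card (Iso G G)

/-- Two graphs are edge isomorphic if there is an isomorphism fixing every vertex, i.e. if they
differ only in the names of (the ends of) the internal edges. -/
def EdgeIso (G H : RawGraph n s) : Prop := ∃ φ : Iso G H, φ.vertexEquiv = Equiv.refl _

/-- The underlying simple graph: two distinct vertices are adjacent if they are connected by an
internal edge. -/
def toSimpleGraph (G : RawGraph n s) : SimpleGraph (Fin n) :=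
  SimpleGraph.fromRel fun u v => ∃ j, G.att (Sum.inl (j, 0)) = u ∧ G.att (Sum.inl (j, 1)) = v

/-- Any two vertices are joined by a path (and there is at least one vertex). -/
def IsConnected (G : RawGraph n s) : Prop := G.toSimpleGraph.Connected

/-- No internal edge has both ends at the same vertex. -/
def IsLoopless (G : RawGraph n s) : Prop :=
  ∀ j, G.att (Sum.inl (j, 0)) ≠ G.att (Sum.inl (j, 1))

/-- The boundary map over `ℤ/2`: a set of internal edges is sent to the parity, at each vertex, of
the number of ends of these edges assigned to that vertex. -/
def boundary (G : RawGraph n s) : (Fin G.m → ZMod 2) →ₗ[ZMod 2] (Fin n → ZMod 2) where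
  toFun x := fun v => ∑ a : Fin G.m × Fin 2, if G.att (Sum.inl a) = v then x a.1 else 0
  map_add' x y := by
    funext v
    simp only [Pi.add_apply]
    rw [← Finset.sum_add_distrib]
    refine Finset.sum_congr rfl fun a _ => ?_
    split_ifs <;> simp
  map_smul' c x := by
    funext v
    simp only [Pi.smul_apply, smul_eq_mul, RingHom.id_apply, Finset.mul_sum]
    refine Finset.sum_congr rfl fun a _ => ?_
    split_ifs <;> simp

/-- The cycle space over `ℤ/2`: the sets of internal edges for which every vertex is assigned an
even number of ends. -/
def cycleSpace (G : RawGraph n s) : Submodule (ZMod 2) (Fin G.m → ZMod 2) :=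
  LinearMap.ker G.boundary

/-- The cyclomatic number: the dimension of the cycle space. -/
noncomputable def cyclomaticNumber (G : RawGraph n s) : ℕ :=
  Module.finrank (ZMod 2) G.cycleSpace

/-- `G.addEdge i j` is `G` with one further internal edge connecting `v_i` and `v_j`. -/
def addEdge (i j : Fin n) (G : RawGraph n s) : RawGraph n s where
  m := G.m + 1
  att := Sum.elim
    (fun a => Fin.lastCases (motive := fun _ => Fin n) (if a.2 = 0 then i else j)
      (fun e => G.att (Sum.inl (e, a.2))) a.1)
    (fun z => G.att (Sum.inr z))

/-- The set of the ends of (internal and external) edges assigned to the vertex `v_i`. -/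
def endsAt (G : RawGraph n s) (i : Fin n) : Finset ((Fin G.m × Fin 2) ⊕ Fin s) :=
  Finset.univ.filter fun x => G.att x = i

/-- Add a new vertex `v_{n+1}` and reassign to it exactly the ends in `A`. -/
def split (G : RawGraph n s) (A : Finset ((Fin G.m × Fin 2) ⊕ Fin s)) : RawGraph (n + 1) s where
  m := G.m
  att x := if x ∈ A then Fin.last n else (G.att x).castSucc

/-- Reflexivity. -/
def Iso.refl (G : RawGraph n s) : Iso G G :=
  ⟨Equiv.refl _, Equiv.refl _, fun _ _ => Iff.rfl, fun _ => rfl, fun _ => rfl⟩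

/-- The inverse isomorphism. -/
def Iso.symm {G H : RawGraph n s} (φ : Iso G H) : Iso H G where
  vertexEquiv := φ.vertexEquiv.symm
  endEquiv := φ.endEquiv.symm
  edge a b := by
    have h := φ.edge (φ.endEquiv.symm a) (φ.endEquiv.symm b)
    simp only [Equiv.apply_symm_apply] at h
    exact h.symm
  att_int a := by
    have h := φ.att_int (φ.endEquiv.symm a)
    simp only [Equiv.apply_symm_apply] at h
    rw [h, Equiv.symm_apply_apply]
  att_ext z := by rw [φ.att_ext z, Equiv.symm_apply_apply]

/-- Composition of isomorphisms. -/
def Iso.trans {G H K : RawGraph n s} (φ : Iso G H) (χ : Iso H K) : Iso G K where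
  vertexEquiv := φ.vertexEquiv.trans χ.vertexEquiv
  endEquiv := φ.endEquiv.trans χ.endEquiv
  edge a b := by
    simp only [Equiv.trans_apply]
    rw [χ.edge, φ.edge]
  att_int a := by
    simp only [Equiv.trans_apply]
    rw [χ.att_int, φ.att_int]
  att_ext z := by
    simp only [Equiv.trans_apply]
    rw [χ.att_ext, φ.att_ext]

/-- Graphs up to the names of (the ends of) internal edges. -/
instance edgeSetoid (n s : ℕ) : Setoid (RawGraph n s) where
  r := EdgeIso
  iseqv :=
    { refl := fun G => ⟨Iso.refl G, rfl⟩
      symm := by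
        rintro G H ⟨φ, h⟩
        exact ⟨φ.symm, by simp [Iso.symm, h]⟩
      trans := by
        rintro G H K ⟨φ, h⟩ ⟨χ, h'⟩
        exact ⟨φ.trans χ, by simp [Iso.trans, h, h']⟩ }

/-- Adding an edge respects edge isomorphism. -/
theorem addEdge_congr (i j : Fin n) {G H : RawGraph n s} (h : EdgeIso G H) :
    EdgeIso (G.addEdge i j) (H.addEdge i j) := by
  obtain ⟨φ, hφ⟩ := h
  let f : ∀ {G H : RawGraph n s}, (Fin G.m × Fin 2 → Fin H.m × Fin 2) →
      Fin (G.m + 1) × Fin 2 → Fin (H.m + 1) × Fin 2 := fun {G H} g a =>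
    Fin.lastCases (motive := fun _ => Fin (H.m + 1) × Fin 2) (Fin.last _, a.2)
      (fun e => ((g (e, a.2)).1.castSucc, (g (e, a.2)).2)) a.1
  have fl : ∀ {G H : RawGraph n s} (g : Fin G.m × Fin 2 → Fin H.m × Fin 2) (b : Fin 2),
      f g (Fin.last _, b) = (Fin.last _, b) := by intro G H g b; simp [f]
  have fc : ∀ {G H : RawGraph n s} (g : Fin G.m × Fin 2 → Fin H.m × Fin 2) (e) (b : Fin 2),
      f g (Fin.castSucc e, b) = ((g (e, b)).1.castSucc, (g (e, b)).2) := by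
    intro G H g e b; simp [f]
  have inv : ∀ {G H : RawGraph n s} (g : Fin G.m × Fin 2 ≃ Fin H.m × Fin 2),
      Function.LeftInverse (f (G := H) (H := G) g.symm) (f (G := G) (H := H) g) := by
    rintro G H g ⟨e, b⟩
    induction e using Fin.lastCases with
    | last => rw [fl, fl]
    | cast e => rw [fc, fc]; simp
  refine ⟨⟨Equiv.refl _, ⟨f φ.endEquiv, f φ.endEquiv.symm, inv _, ?_⟩, ?_, ?_, ?_⟩, rfl⟩
  · exact inv (G := H) (H := G) φ.endEquiv.symm
  · rintro ⟨e, b⟩ ⟨e', b'⟩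
    have hE := φ.edge
    change (f φ.endEquiv (e, b)).1 = (f φ.endEquiv (e', b')).1 ↔ e = e'
    induction e using Fin.lastCases with
    | last =>
      induction e' using Fin.lastCases with
      | last => rw [fl, fl]; exact iff_of_true rfl rfl
      | cast e' =>
        rw [fl, fc]
        exact iff_of_false (Fin.castSucc_lt_last _).ne' (Fin.castSucc_lt_last _).ne'
    | cast e =>
      induction e' using Fin.lastCases with
      | last =>
        rw [fl, fc]
        exact iff_of_false (Fin.castSucc_lt_last _).ne (Fin.castSucc_lt_last _).ne
      | cast e' =>
        rw [fc, fc]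
        exact (Fin.castSucc_injective _).eq_iff.trans
          ((hE (e, b) (e', b')).trans (Fin.castSucc_injective _).eq_iff.symm)
  · rintro ⟨e, b⟩
    have hA := φ.att_int
    change (H.addEdge i j).att (Sum.inl (f φ.endEquiv (e, b))) = _
    induction e using Fin.lastCases with
    | last => rw [fl]; simp [addEdge]
    | cast e =>
      rw [fc]
      have := hA (e, b)
      rw [hφ] at this
      simpa [addEdge] using this
  · intro z
    have := φ.att_ext z
    rw [hφ] at this
    simpa [addEdge] using this

/-- Splitting respects edge isomorphism, after renaming the ends. -/
theorem split_congr {G H : RawGraph n s} (φ : Iso G H) (hφ : φ.vertexEquiv = Equiv.refl _)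
    (A : Finset ((Fin G.m × Fin 2) ⊕ Fin s)) :
    EdgeIso (G.split A)
      (H.split (A.map (Equiv.sumCongr φ.endEquiv (Equiv.refl (Fin s))).toEmbedding)) := by
  have key : ∀ x x', H.att x' = G.att x →
      x' = Equiv.sumCongr φ.endEquiv (Equiv.refl (Fin s)) x →
      (H.split (A.map (Equiv.sumCongr φ.endEquiv (Equiv.refl (Fin s))).toEmbedding)).att x' =
        (G.split A).att x := by
    rintro x x' h rfl
    have hm : Equiv.sumCongr φ.endEquiv (Equiv.refl (Fin s)) x ∈
        A.map (Equiv.sumCongr φ.endEquiv (Equiv.refl (Fin s))).toEmbedding ↔ x ∈ A := by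
      rw [Finset.mem_map_equiv, Equiv.symm_apply_apply]
    simp only [split, hm, h]
  refine ⟨⟨Equiv.refl _, φ.endEquiv, φ.edge, ?_, ?_⟩, rfl⟩
  · intro a
    refine key (Sum.inl a) (Sum.inl (φ.endEquiv a)) ?_ rfl
    simpa [hφ] using φ.att_int a
  · intro z
    refine key (Sum.inr z) (Sum.inr z) ?_ rfl
    simpa [hφ] using φ.att_ext z

end RawGraph

/-- Graphs on the vertices `v_1, …, v_n` with external edges labelled `x_1, …, x_s`, where the names
of the ends of internal edges are disregarded. -/
abbrev VGraph (n s : ℕ) : Type := Quotient (RawGraph.edgeSetoid n s)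

namespace VGraph

variable {n s : ℕ}

/-- The graph given by a concrete naming of its ends. -/
def mk (G : RawGraph n s) : VGraph n s := Quotient.mk _ G

/-- The set of loopless connected graphs with `n` vertices, cyclomatic number `k` and `s` external
edges with free ends labelled `x_1, …, x_s`. -/
def loopless (n k s : ℕ) : Set (VGraph n s) :=
  mk '' {G : RawGraph n s | G.IsConnected ∧ G.IsLoopless ∧ G.cyclomaticNumber = k}

/-- The equivalence class, under graph isomorphism, of the graph `G`. -/
def isoClass (G : RawGraph n s) : Set (VGraph n s) :=
  mk '' {H : RawGraph n s | Nonempty (RawGraph.Iso G H)}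

/-- Connecting two vertices with an internal edge. -/
def addEdge (i j : Fin n) : VGraph n s → VGraph n s :=
  Quotient.map (RawGraph.addEdge i j) fun _ _ h => RawGraph.addEdge_congr i j h

/-- The linear map `l_{i,j}`, connecting the vertices `v_i` and `v_j` with an internal edge. -/
noncomputable def l (i j : Fin n) : (VGraph n s →₀ ℚ) →ₗ[ℚ] (VGraph n s →₀ ℚ) :=
  Finsupp.lmapDomain ℚ ℚ (addEdge i j)

/-- The sum of all graphs obtained from `G` by splitting the vertex `v_i` into `v_i` and `v_{n+1}`
and distributing the ends assigned to `v_i` between the two in all possible ways.  The summand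
`A` is the one in which the ends in `A` go to `v_{n+1}`, the other ones stay at `v_i`. -/
noncomputable def splitRaw (i : Fin n) (G : RawGraph n s) : VGraph (n + 1) s →₀ ℚ :=
  ∑ A ∈ (G.endsAt i).powerset, Finsupp.single (mk (G.split A)) 1

theorem splitRaw_congr (i : Fin n) (G H : RawGraph n s) (h : RawGraph.EdgeIso G H) :
    splitRaw i G = splitRaw i H := by
  obtain ⟨φ, hφ⟩ := h
  set ψ := Equiv.sumCongr φ.endEquiv (Equiv.refl (Fin s)) with hψ
  have hatt : ∀ x, H.att (ψ x) = G.att x := by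
    rintro (a | z)
    · have := φ.att_int a
      rw [hφ] at this
      simpa [hψ] using this
    · have := φ.att_ext z
      rw [hφ] at this
      simpa [hψ] using this
  have hmem : ∀ x, x ∈ G.endsAt i ↔ ψ x ∈ H.endsAt i := by
    intro x
    simp [RawGraph.endsAt, hatt]
  unfold splitRaw
  refine Finset.sum_bij (fun A _ => A.map ψ.toEmbedding) ?_ ?_ ?_ ?_
  · intro A hA
    rw [Finset.mem_powerset] at hA ⊢
    intro y hy
    obtain ⟨x, hx, rfl⟩ := Finset.mem_map.1 hy
    exact (hmem x).1 (hA hx)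
  · intro A _ B _ h
    exact Finset.map_injective _ h
  · intro B hB
    refine ⟨B.map ψ.symm.toEmbedding, ?_, ?_⟩
    · rw [Finset.mem_powerset] at hB ⊢
      intro y hy
      obtain ⟨x, hx, rfl⟩ := Finset.mem_map.1 hy
      exact (hmem _).2 (by simpa using hB hx)
    · ext y
      simp [Finset.mem_map_equiv]
  · intro A _
    have : mk (G.split A) = mk (H.split (A.map ψ.toEmbedding)) :=
      Quotient.sound (RawGraph.split_congr φ hφ A)
    rw [this]

/-- The linear map `s_{𝓔_i}`, splitting the vertex `v_i`. -/
noncomputable def splitVertex (i : Fin n) :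
    (VGraph n s →₀ ℚ) →ₗ[ℚ] (VGraph (n + 1) s →₀ ℚ) :=
  Finsupp.linearCombination ℚ (Quotient.lift (splitRaw i) (splitRaw_congr i))

/-- The linear map `q_i^{(ρ)} = (1 / (2 (ρ - 1)!)) l_{i,n+1}^ρ ∘ s_{𝓔_i}` (for `ρ ≥ 1`). -/
noncomputable def q (ρ : ℕ) (i : Fin n) : (VGraph n s →₀ ℚ) →ₗ[ℚ] (VGraph (n + 1) s →₀ ℚ) :=
  (1 / (2 * ((ρ - 1).factorial : ℚ))) • ((l i.castSucc (Fin.last n) ^ ρ) ∘ₗ splitVertex i)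

/-- The single vertex with `s` external edges whose free ends are labelled `x_1, …, x_s`. -/
def singleVertex (s : ℕ) : VGraph 1 s := mk ⟨0, fun _ => 0⟩

/-- The recursively defined linear combination of graphs with `n` vertices, of cyclomatic number
`k`, with `s` external edges.  The value for `n = 0` is irrelevant. -/
noncomputable def thetaHat (s : ℕ) : (n k : ℕ) → (VGraph n s →₀ ℚ)
  | 0, _ => 0
  | 1, k => if k = 0 then Finsupp.single (singleVertex s) 1 else 0
  | n + 2, k => (1 / ((k : ℚ) + ((n + 2 : ℕ) : ℚ) - 1)) •
      ∑ ρ ∈ Finset.Icc 1 (k + 1), ∑ i : Fin (n + 1), q ρ i (thetaHat s (n + 1) (k + 1 - ρ))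

end VGraph

/-! Parts 1 and 2 need no cancellation argument, since every coefficient in the recursion is
nonnegative. Splitting `v_i` and joining the two halves by `ρ ≥ 1` edges is inverted by deleting all
edges between `v_i` and the last vertex and merging the two. The larger graph is connected and
loopless exactly when the merged one is (`isAdmissible_contract`). In a connected graph with at
least two vertices the last vertex has a neighbour, so every admissible graph is reached with
positive weight.

Part 3 compares `thetaHat` with a uniform count of graphs whose edges and ends are named, i.e. of
assignments `f : Att n s m`. For every isomorphism-invariant `Λ`, `n! m! 2^m` times the pairing of
`Λ` with `thetaHat` equals the sum of `Λ` over all admissible assignments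
(`linearCombination_thetaHat`). For `Λ` the indicator of an isomorphism class, orbit-stabilizer says
that this sum is `n! m! 2^m / S` (`sum_indicator_isoClass`), which gives the claim.

The identity is proved by induction on the number of vertices. Pulling `Λ` back along the splitting
maps gives an invariant function on smaller graphs. Choosing names and directions for the `ρ` new
edges among `r + ρ` accounts for `2^ρ (r+ρ)!/(ρ! r!)` (`sum_mult_eq`). Since `1/(ρ-1)! = ρ/ρ!`, a
graph is weighted by the number `ρ` of edges between `v_i` and the last vertex. Summed over `i`,
this is the internal degree of the last vertex. By invariance that degree may be averaged over all
vertices, where the total is `2m` by the handshake lemma. The factor `1/2` in `q` and the factor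
`1/(k+n-1) = 1/m` cancel this total. -/

namespace RawGraph

variable {n s : ℕ}

/-! ### Ends, isomorphisms, and connectedness through closed sets. -/

/-- The other end of the same internal edge. -/
def flip {m : ℕ} (a : Fin m × Fin 2) : Fin m × Fin 2 := (a.1, a.2.rev)

@[simp] theorem flip_fst {m : ℕ} (a : Fin m × Fin 2) : (flip a).1 = a.1 := rfl

@[simp] theorem flip_flip {m : ℕ} (a : Fin m × Fin 2) : flip (flip a) = a := by
  simp [flip]

theorem flip_ne {m : ℕ} (a : Fin m × Fin 2) : flip a ≠ a := by
  obtain ⟨e, b⟩ := a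
  fin_cases b <;> simp [flip, Prod.ext_iff]

theorem eq_flip {m : ℕ} {a b : Fin m × Fin 2} (h : a.1 = b.1) (hne : a ≠ b) : a = flip b := by
  obtain ⟨e, c⟩ := a
  obtain ⟨f, d⟩ := b
  obtain rfl : e = f := h
  fin_cases c <;> fin_cases d <;> simp_all [flip]

theorem perm_fin_two_rev (τ : Equiv.Perm (Fin 2)) (b : Fin 2) : τ b.rev = (τ b).rev := by
  revert τ b
  decide

theorem Iso.endEquiv_flip {G H : RawGraph n s} (φ : Iso G H) (a : Fin G.m × Fin 2) :
    φ.endEquiv (flip a) = flip (φ.endEquiv a) :=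
  eq_flip ((φ.edge _ _).2 rfl) fun h => flip_ne a (φ.endEquiv.injective h)

/-- An isomorphism from compatibility with the exchange of the two ends of every edge. -/
def Iso.ofFlip {G H : RawGraph n s} (σ : Fin n ≃ Fin n) (ε : Fin G.m × Fin 2 ≃ Fin H.m × Fin 2)
    (hε : ∀ a, ε (flip a) = flip (ε a)) (h₁ : ∀ a, H.att (Sum.inl (ε a)) = σ (G.att (Sum.inl a)))
    (h₂ : ∀ z, H.att (Sum.inr z) = σ (G.att (Sum.inr z))) : Iso G H where
  vertexEquiv := σ
  endEquiv := ε
  edge a b := by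
    constructor
    · intro h
      by_cases hab : a = b
      · rw [hab]
      · have := eq_flip h fun h' => hab (ε.injective h')
        rw [← hε, ε.injective.eq_iff] at this
        rw [this, flip_fst]
    · intro h
      by_cases hab : a = b
      · rw [hab]
      · rw [eq_flip h hab, hε, flip_fst]
  att_int := h₁
  att_ext := h₂

theorem Iso.m_eq {G H : RawGraph n s} (φ : Iso G H) : G.m = H.m := by
  have := Fintype.card_congr φ.endEquiv
  simpa using this

/-- A set of vertices is closed if no internal edge leaves it. -/
def IsClosedSet (G : RawGraph n s) (S : Set (Fin n)) : Prop :=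
  ∀ a, G.att (Sum.inl a) ∈ S → G.att (Sum.inl (flip a)) ∈ S

theorem isClosedSet_iff (G : RawGraph n s) (S : Set (Fin n)) :
    G.IsClosedSet S ↔ ∀ e, G.att (Sum.inl (e, 0)) ∈ S ↔ G.att (Sum.inl (e, 1)) ∈ S := by
  constructor
  · intro h e
    exact ⟨h (e, 0), h (e, 1)⟩
  · rintro h ⟨e, b⟩
    fin_cases b
    · exact (h e).1
    · exact (h e).2

/-- The set of vertices reachable from `u` is closed, and a walk never leaves a closed set. In this
form connectedness is easy to follow when edges are added or vertices are merged. -/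
theorem isConnected_iff (G : RawGraph n s) :
    G.IsConnected ↔ 0 < n ∧ ∀ S, G.IsClosedSet S → ∀ u v, u ∈ S → v ∈ S := by
  rw [IsConnected, SimpleGraph.connected_iff]
  constructor
  · rintro ⟨hp, ⟨u₀⟩⟩
    refine ⟨u₀.pos, fun S hS u v hu => ?_⟩
    obtain ⟨w⟩ := hp u v
    induction w with
    | nil => exact hu
    | cons hadj _ ih =>
      refine ih ?_
      rw [toSimpleGraph, SimpleGraph.fromRel_adj] at hadj
      rw [isClosedSet_iff] at hS
      obtain ⟨_, ⟨e, rfl, rfl⟩ | ⟨e, rfl, rfl⟩⟩ := hadj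
      · exact (hS e).1 hu
      · exact (hS e).2 hu
  · rintro ⟨hn, h⟩
    refine ⟨fun u v => ?_, ⟨⟨0, hn⟩⟩⟩
    refine h {w | G.toSimpleGraph.Reachable u w} ?_ u v (SimpleGraph.Reachable.refl u)
    rw [isClosedSet_iff]
    intro e
    by_cases he : G.att (Sum.inl (e, 0)) = G.att (Sum.inl (e, 1))
    · rw [he]
    · have hadj : G.toSimpleGraph.Adj (G.att (Sum.inl (e, 0))) (G.att (Sum.inl (e, 1))) := by
        rw [toSimpleGraph, SimpleGraph.fromRel_adj]
        exact ⟨he, Or.inl ⟨e, rfl, rfl⟩⟩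
      exact ⟨fun h => h.trans hadj.reachable, fun h => h.trans hadj.symm.reachable⟩

theorem isLoopless_iff (G : RawGraph n s) :
    G.IsLoopless ↔ ∀ a, G.att (Sum.inl a) ≠ G.att (Sum.inl (flip a)) := by
  constructor
  · rintro h ⟨e, b⟩
    fin_cases b
    · exact h e
    · exact (h e).symm
  · exact fun h e => h (e, 0)

/-- Connected graphs without loops. -/
def IsAdmissible (G : RawGraph n s) : Prop := G.IsConnected ∧ G.IsLoopless

theorem Iso.isConnected {G H : RawGraph n s} (φ : Iso G H) (h : G.IsConnected) :
    H.IsConnected := by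
  rw [isConnected_iff] at h ⊢
  refine ⟨h.1, fun S hS u v hu => ?_⟩
  have := h.2 (φ.vertexEquiv ⁻¹' S) (fun a ha => ?_) (φ.vertexEquiv.symm u) (φ.vertexEquiv.symm v)
    (by simpa using hu)
  · simpa using this
  · rw [Set.mem_preimage, ← φ.att_int] at ha ⊢
    rw [φ.endEquiv_flip]
    exact hS _ ha

theorem Iso.isLoopless {G H : RawGraph n s} (φ : Iso G H) (h : G.IsLoopless) : H.IsLoopless := by
  rw [isLoopless_iff] at h ⊢
  intro a
  obtain ⟨a, rfl⟩ := φ.endEquiv.surjective a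
  rw [← φ.endEquiv_flip, φ.att_int, φ.att_int, φ.vertexEquiv.injective.ne_iff]
  exact h a

theorem Iso.isAdmissible_iff {G H : RawGraph n s} (φ : Iso G H) :
    G.IsAdmissible ↔ H.IsAdmissible :=
  ⟨fun h => ⟨φ.isConnected h.1, φ.isLoopless h.2⟩,
    fun h => ⟨φ.symm.isConnected h.1, φ.symm.isLoopless h.2⟩⟩

/-! ### The cyclomatic number of a connected graph. -/

/-- The incidence matrix over `ℤ/2`. -/
def incidence (G : RawGraph n s) : Matrix (Fin n) (Fin G.m) (ZMod 2) :=
  Matrix.of fun v e => ∑ b : Fin 2, if G.att (Sum.inl (e, b)) = v then 1 else 0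

theorem boundary_eq_mulVecLin (G : RawGraph n s) : G.boundary = G.incidence.mulVecLin := by
  refine LinearMap.ext fun x => funext fun v => ?_
  change ∑ a : Fin G.m × Fin 2, _ = ∑ e, G.incidence v e * x e
  rw [Fintype.sum_prod_type]
  refine Finset.sum_congr rfl fun e _ => ?_
  simp only [incidence, Matrix.of_apply, Finset.sum_mul, ite_mul, one_mul, zero_mul]

/-- Rank-nullity for the incidence matrix and for its transpose, which have equal rank. The kernel
of the transpose consists of the functions constant along edges, which by connectedness are just the
constants. -/
theorem IsConnected.cyclomaticNumber_add {G : RawGraph n s} (h : G.IsConnected) :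
    G.cyclomaticNumber + n = G.m + 1 := by
  rw [isConnected_iff] at h
  obtain ⟨hn, h⟩ := h
  have h₁ := G.incidence.mulVecLin.finrank_range_add_finrank_ker
  have h₂ := G.incidence.transpose.mulVecLin.finrank_range_add_finrank_ker
  have h₃ : G.incidence.transpose.rank = G.incidence.rank := Matrix.rank_transpose _
  have h₄ : LinearMap.ker G.incidence.transpose.mulVecLin = Submodule.span (ZMod 2) {1} := by
    ext f
    rw [LinearMap.mem_ker, Submodule.mem_span_singleton]
    have hf : G.incidence.transpose.mulVecLin f =
        fun e => f (G.att (Sum.inl (e, 0))) + f (G.att (Sum.inl (e, 1))) := by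
      ext e
      change ∑ v, G.incidence v e * f v = _
      simp only [incidence, Matrix.of_apply, Fin.sum_univ_two, add_mul, Finset.sum_add_distrib,
        ite_mul, one_mul, zero_mul, Finset.sum_ite_eq, Finset.mem_univ, if_true]
    rw [hf]
    constructor
    · intro h0
      refine ⟨f ⟨0, hn⟩, ?_⟩
      ext v
      -- A level set of `f` is closed, because `f` agrees at the two ends of every edge.
      have := h {w | f w = f ⟨0, hn⟩} ?_ ⟨0, hn⟩ v rfl
      · simpa using this.symm
      · rw [isClosedSet_iff]
        intro e
        have he : f (G.att (Sum.inl (e, 0))) = f (G.att (Sum.inl (e, 1))) :=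
          CharTwo.add_eq_zero.1 (congrFun h0 e)
        simp only [Set.mem_ofPred_eq, he]
    · rintro ⟨c, rfl⟩
      ext e
      simpa using CharTwo.add_self_eq_zero c
  have h₅ : Module.finrank (ZMod 2) (LinearMap.ker G.incidence.transpose.mulVecLin) = 1 := by
    rw [h₄]
    refine finrank_span_singleton fun h0 => ?_
    simpa using congrFun h0 ⟨0, hn⟩
  rw [Matrix.rank, Matrix.rank] at h₃
  simp only [Module.finrank_fin_fun] at h₁ h₂
  rw [cyclomaticNumber, cycleSpace, boundary_eq_mulVecLin]
  omega

/-! ### Edge multiplicities and the effect of adding edges. -/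

/-- The number of internal edges connecting two distinct vertices. -/
def mult (i j : Fin n) (G : RawGraph n s) : ℕ :=
  (Finset.univ.filter fun a => G.att (Sum.inl a) = i ∧ G.att (Sum.inl (flip a)) = j).card

theorem Iso.mult_eq {G H : RawGraph n s} (φ : Iso G H) (i j : Fin n) :
    H.mult (φ.vertexEquiv i) (φ.vertexEquiv j) = G.mult i j := by
  symm
  refine Finset.card_equiv φ.endEquiv fun a => ?_
  simp [← φ.endEquiv_flip, φ.att_int]

theorem mult_congr {G H : RawGraph n s} (h : EdgeIso G H) (i j : Fin n) :
    G.mult i j = H.mult i j := by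
  obtain ⟨φ, hφ⟩ := h
  simpa [hφ] using (φ.mult_eq i j).symm

/-- The assignment of ends in a graph with one further edge. -/
def extend {m : ℕ} (i j : Fin n) (f : (Fin m × Fin 2) ⊕ Fin s → Fin n) :
    (Fin (m + 1) × Fin 2) ⊕ Fin s → Fin n :=
  (addEdge i j ⟨m, f⟩).att

section extend

variable {m : ℕ} (i j : Fin n) (f : (Fin m × Fin 2) ⊕ Fin s → Fin n)

theorem addEdge_mk : addEdge i j ⟨m, f⟩ = ⟨m + 1, extend i j f⟩ := rfl

@[simp] theorem extend_last_zero : extend i j f (Sum.inl (Fin.last m, 0)) = i := by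
  simp [extend, addEdge]

@[simp] theorem extend_last_one : extend i j f (Sum.inl (Fin.last m, 1)) = j := by
  simp [extend, addEdge]

@[simp] theorem extend_castSucc (e : Fin m) (b : Fin 2) :
    extend i j f (Sum.inl (e.castSucc, b)) = f (Sum.inl (e, b)) := by
  simp [extend, addEdge]

end extend

theorem mult_mk {m : ℕ} (i j : Fin n) (f : (Fin m × Fin 2) ⊕ Fin s → Fin n) :
    mult i j ⟨m, f⟩ =
      ∑ a, if f (Sum.inl a) = i ∧ f (Sum.inl (flip a)) = j then 1 else 0 := by
  rw [mult, Finset.card_filter]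

theorem mult_addEdge {i j : Fin n} (hij : i ≠ j) (G : RawGraph n s) :
    (G.addEdge i j).mult i j = G.mult i j + 1 := by
  obtain ⟨m, f⟩ := G
  rw [addEdge_mk, mult_mk, mult_mk, Fintype.sum_prod_type, Fintype.sum_prod_type,
    Fin.sum_univ_castSucc]
  congr 1
  · refine Finset.sum_congr rfl fun e _ => Finset.sum_congr rfl fun b _ => ?_
    simp only [flip, extend_castSucc]
    rfl
  · simp [flip, hij, hij.symm]

theorem isLoopless_addEdge {i j : Fin n} (hij : i ≠ j) (G : RawGraph n s) :
    (G.addEdge i j).IsLoopless ↔ G.IsLoopless := by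
  obtain ⟨m, f⟩ := G
  simp [addEdge_mk, IsLoopless, Fin.forall_fin_succ', hij]

theorem isClosedSet_addEdge (i j : Fin n) (G : RawGraph n s) (S : Set (Fin n)) :
    (G.addEdge i j).IsClosedSet S ↔ G.IsClosedSet S ∧ (i ∈ S ↔ j ∈ S) := by
  obtain ⟨m, f⟩ := G
  simp [addEdge_mk, isClosedSet_iff, Fin.forall_fin_succ']

theorem isLoopless_addEdge_iterate {i j : Fin n} (hij : i ≠ j) (G : RawGraph n s) (ρ : ℕ) :
    ((addEdge i j)^[ρ] G).IsLoopless ↔ G.IsLoopless := by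
  induction ρ with
  | zero => rfl
  | succ ρ ih => rw [Function.iterate_succ_apply', isLoopless_addEdge hij, ih]

/-- The exponent is `ρ + 1` because at least one new edge is needed to tie `i` and `j` together;
further parallel edges add no condition. -/
theorem isClosedSet_addEdge_iterate (i j : Fin n) (G : RawGraph n s) (S : Set (Fin n)) (ρ : ℕ) :
    ((addEdge i j)^[ρ + 1] G).IsClosedSet S ↔ G.IsClosedSet S ∧ (i ∈ S ↔ j ∈ S) := by
  induction ρ with
  | zero => exact isClosedSet_addEdge i j G S
  | succ ρ ih => rw [Function.iterate_succ_apply', isClosedSet_addEdge, ih]; tauto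

theorem m_addEdge_iterate (i j : Fin n) (G : RawGraph n s) (ρ : ℕ) :
    ((addEdge i j)^[ρ] G).m = G.m + ρ := by
  induction ρ with
  | zero => rfl
  | succ ρ ih =>
    rw [Function.iterate_succ_apply']
    exact congrArg (· + 1) ih

end RawGraph

/-! ### Counting assignments of named ends with marked edges. -/

namespace VGraph

variable {n s : ℕ}

/-- The assignments of the ends of `m` internal and `s` external edges to `n` vertices. -/
abbrev Att (n s m : ℕ) : Type := (Fin m × Fin 2) ⊕ Fin s → Fin n

/-- The number of internal edges connecting two distinct vertices. -/
def mult (i j : Fin n) : VGraph n s → ℕ :=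
  Quotient.lift (RawGraph.mult i j) fun _ _ h => RawGraph.mult_congr h i j

@[simp] theorem mult_mk (i j : Fin n) (G : RawGraph n s) : mult i j (mk G) = G.mult i j := rfl

@[simp] theorem addEdge_mk (i j : Fin n) (G : RawGraph n s) :
    addEdge i j (mk G) = mk (G.addEdge i j) := rfl

theorem addEdge_iterate_mk (i j : Fin n) (G : RawGraph n s) (ρ : ℕ) :
    (addEdge i j)^[ρ] (mk G) = mk ((RawGraph.addEdge i j)^[ρ] G) := by
  induction ρ with
  | zero => rfl
  | succ ρ ih => rw [Function.iterate_succ_apply', ih, addEdge_mk, Function.iterate_succ_apply']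

theorem mult_addEdge {i j : Fin n} (hij : i ≠ j) (G : VGraph n s) :
    mult i j (addEdge i j G) = mult i j G + 1 := by
  induction G using Quotient.inductionOn with
  | h G => exact RawGraph.mult_addEdge hij G

theorem mk_eq_mk {G H : RawGraph n s} (φ : RawGraph.Iso G H)
    (h : φ.vertexEquiv = Equiv.refl _) : mk G = mk H :=
  Quotient.sound ⟨φ, h⟩

theorem exists_iso_of_mk_eq {G H : RawGraph n s} (h : mk G = mk H) :
    ∃ φ : RawGraph.Iso G H, φ.vertexEquiv = Equiv.refl _ :=
  Quotient.exact h

/-- The set of connected graphs without loops. -/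
def admissible (n s : ℕ) : Set (VGraph n s) := mk '' {G | G.IsAdmissible}

@[simp] theorem mk_mem_admissible {G : RawGraph n s} : mk G ∈ admissible n s ↔ G.IsAdmissible := by
  constructor
  · rintro ⟨H, hH, h⟩
    obtain ⟨φ, -⟩ := exists_iso_of_mk_eq h
    exact φ.isAdmissible_iff.1 hH
  · exact fun h => ⟨G, h, rfl⟩

theorem mk_mem_loopless {k : ℕ} {G : RawGraph n s} :
    mk G ∈ loopless n k s ↔ G.IsAdmissible ∧ G.m + 1 = n + k := by
  constructor
  · rintro ⟨H, ⟨h₁, h₂, h₃⟩, h⟩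
    obtain ⟨φ, -⟩ := exists_iso_of_mk_eq h
    refine ⟨φ.isAdmissible_iff.1 ⟨h₁, h₂⟩, ?_⟩
    have := h₁.cyclomaticNumber_add
    rw [← φ.m_eq]
    omega
  · rintro ⟨h, hm⟩
    refine ⟨G, ⟨h.1, h.2, ?_⟩, rfl⟩
    have := h.1.cyclomaticNumber_add
    omega

/-- The permutation of the ends of internal edges given by a permutation of the edges and one of
the two positions in an edge. -/
def endPerm {m : ℕ} (σ : Equiv.Perm (Fin m)) (τ : Equiv.Perm (Fin 2)) :
    Equiv.Perm ((Fin m × Fin 2) ⊕ Fin s) :=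
  Equiv.sumCongr (Equiv.prodCongr σ τ) (Equiv.refl _)

theorem mk_comp_endPerm {m : ℕ} (σ : Equiv.Perm (Fin m)) (τ : Equiv.Perm (Fin 2))
    (f : Att n s m) : mk ⟨m, f ∘ endPerm σ τ⟩ = mk ⟨m, f⟩ := by
  refine mk_eq_mk (RawGraph.Iso.ofFlip (G := ⟨m, f ∘ endPerm σ τ⟩) (H := ⟨m, f⟩) (Equiv.refl _)
    (Equiv.prodCongr σ τ) ?_ ?_ ?_) rfl
  · rintro ⟨e, b⟩
    exact Prod.ext rfl (RawGraph.perm_fin_two_rev τ b)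
  · exact fun _ => rfl
  · exact fun _ => rfl

/-- Forgetting the last internal edge. -/
def restrict {m : ℕ} (f : Att n s (m + 1)) : Att n s m :=
  fun x => f (Sum.map (Prod.map Fin.castSucc id) id x)

theorem restrict_extend {m : ℕ} (i j : Fin n) (f : Att n s m) :
    restrict (RawGraph.extend i j f) = f := by
  ext1 x
  rcases x with ⟨e, b⟩ | z
  · exact RawGraph.extend_castSucc i j f e b
  · rfl

theorem extend_restrict {m : ℕ} (f : Att n s (m + 1)) :
    RawGraph.extend (f (Sum.inl (Fin.last m, 0))) (f (Sum.inl (Fin.last m, 1))) (restrict f) =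
      f := by
  ext1 x
  rcases x with ⟨e, b⟩ | z
  · induction e using Fin.lastCases with
    | last => fin_cases b <;> simp
    | cast e => simp [restrict]
  · rfl

/-- By symmetry under renaming, any chosen end may be taken to be the first end of the last edge,
the one that `addEdge` creates. -/
theorem exists_endPerm {m : ℕ} (a : Fin (m + 1) × Fin 2) :
    ∃ (σ : Equiv.Perm (Fin (m + 1))) (τ : Equiv.Perm (Fin 2)),
      (σ (Fin.last m), τ 0) = a ∧ (σ (Fin.last m), τ 1) = RawGraph.flip a := by
  refine ⟨Equiv.swap (Fin.last m) a.1, Equiv.swap 0 a.2, ?_, ?_⟩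
  · simp
  · obtain ⟨e, b⟩ := a
    fin_cases b <;> simp [RawGraph.flip]

/-- A graph with an edge connecting `v_i` and `v_j` is obtained by adding this edge. -/
theorem exists_eq_addEdge {i j : Fin n} {G : RawGraph n s} (h : 0 < G.mult i j) :
    ∃ H, mk G = addEdge i j (mk H) := by
  obtain ⟨m, f⟩ := G
  rw [RawGraph.mult, Finset.card_pos] at h
  obtain ⟨a, ha⟩ := h
  simp only [Finset.mem_filter, Finset.mem_univ, true_and] at ha
  change Fin m × Fin 2 at a
  obtain _ | m := m
  · exact a.1.elim0
  obtain ⟨σ, τ, h₀, h₁⟩ := exists_endPerm a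
  refine ⟨⟨m, restrict (f ∘ endPerm σ τ)⟩, ?_⟩
  have := extend_restrict (f ∘ endPerm σ τ)
  simp only [Function.comp_apply, endPerm, Equiv.sumCongr_apply, Sum.map_inl,
    Equiv.prodCongr_apply, Prod.map, h₀, h₁] at this
  rw [addEdge_mk, RawGraph.addEdge_mk, ← mk_comp_endPerm σ τ]
  congr 2
  rw [← ha.1, ← ha.2]
  exact this.symm

/-- A graph is obtained from one in which `v_i` and `v_j` are not connected by adding edges
connecting them. -/
theorem exists_eq_addEdge_iterate {i j : Fin n} (hij : i ≠ j) (ρ : ℕ) {G : RawGraph n s}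
    (h : G.mult i j = ρ) :
    ∃ H, mk G = (addEdge i j)^[ρ] (mk H) ∧ H.mult i j = 0 := by
  induction ρ generalizing G with
  | zero => exact ⟨G, rfl, h⟩
  | succ ρ ih =>
    obtain ⟨K, hK⟩ := exists_eq_addEdge (G := G) (i := i) (j := j) (by omega)
    have hm : K.mult i j = ρ := by
      have := congrArg (mult i j) hK
      rw [mult_addEdge hij, mult_mk, mult_mk] at this
      omega
    obtain ⟨H, hH, h0⟩ := ih hm
    exact ⟨H, by rw [hK, hH, Function.iterate_succ_apply'], h0⟩

/-- Summing over the graphs with a fixed edge is summing over the graphs without it. -/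
theorem sum_filter_eq_sum_extend {m : ℕ} (i j : Fin n) (F : VGraph n s → ℚ)
    (a : Fin (m + 1) × Fin 2) :
    ∑ f : Att n s (m + 1),
      (if f (Sum.inl a) = i ∧ f (Sum.inl (RawGraph.flip a)) = j then F (mk ⟨m + 1, f⟩) else 0) =
    ∑ f : Att n s m, F (addEdge i j (mk ⟨m, f⟩)) := by
  obtain ⟨σ, τ, h₀, h₁⟩ := exists_endPerm a
  have key := (Equiv.sum_comp (Equiv.arrowCongr (endPerm (s := s) σ τ) (Equiv.refl (Fin n)))
    (fun f : Att n s (m + 1) =>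
      if f (Sum.inl a) = i ∧ f (Sum.inl (RawGraph.flip a)) = j then F (mk ⟨m + 1, f⟩) else 0))
  rw [← key]
  have h₂ : ∀ f : Att n s (m + 1),
      mk ⟨m + 1, Equiv.arrowCongr (endPerm (s := s) σ τ) (Equiv.refl (Fin n)) f⟩ =
        mk ⟨m + 1, f⟩ := by
    intro f
    rw [← mk_comp_endPerm σ τ]
    congr 2
    ext1 x
    simp
  have h₃ : (endPerm (s := s) σ τ).symm (Sum.inl a) = Sum.inl (Fin.last m, 0) := by
    rw [Equiv.symm_apply_eq, ← h₀]; rfl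
  have h₄ : (endPerm (s := s) σ τ).symm (Sum.inl (RawGraph.flip a)) =
      Sum.inl (Fin.last m, 1) := by
    rw [Equiv.symm_apply_eq, ← h₁]; rfl
  simp only [h₂, Equiv.arrowCongr_apply, Function.comp_apply, h₃, h₄, Equiv.refl_apply]
  rw [← Finset.sum_filter]
  refine Finset.sum_bij' (fun f _ => restrict f) (fun f _ => RawGraph.extend i j f) ?_ ?_ ?_ ?_ ?_
  · simp
  · simp
  · intro f hf
    simp only [Finset.mem_filter, Finset.mem_univ, true_and] at hf
    rw [← hf.1, ← hf.2, extend_restrict]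
  · exact fun f _ => restrict_extend i j f
  · intro f hf
    simp only [Finset.mem_filter, Finset.mem_univ, true_and] at hf
    rw [addEdge_mk, RawGraph.addEdge_mk, ← hf.1, ← hf.2, extend_restrict]

/-- Double counting of pairs of a graph and an end at `v_i` whose partner is at `v_j`. Each of the
`2 (m + 1)` positions of that end contributes the same sum. -/
theorem sum_mult_mul {m : ℕ} (i j : Fin n) (F : VGraph n s → ℚ) :
    ∑ f : Att n s (m + 1), (mult i j (mk ⟨m + 1, f⟩) : ℚ) * F (mk ⟨m + 1, f⟩) =
      2 * (m + 1) * ∑ f : Att n s m, F (addEdge i j (mk ⟨m, f⟩)) := by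
  have h : ∀ f : Att n s (m + 1), (mult i j (mk ⟨m + 1, f⟩) : ℚ) * F (mk ⟨m + 1, f⟩) =
      ∑ a, if f (Sum.inl a) = i ∧ f (Sum.inl (RawGraph.flip a)) = j then F (mk ⟨m + 1, f⟩)
        else 0 := by
    intro f
    rw [mult_mk, RawGraph.mult_mk, Nat.cast_sum, Finset.sum_mul]
    exact Finset.sum_congr rfl fun a _ => by split_ifs <;> simp
  simp only [h]
  rw [Finset.sum_comm, Finset.sum_congr rfl fun a _ => sum_filter_eq_sum_extend i j F a]
  simp only [Finset.sum_const, Finset.card_univ, Fintype.card_prod, Fintype.card_fin, nsmul_eq_mul]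
  push_cast
  ring

/-- A graph with exactly `ρ` edges between `v_i` and `v_j` is a graph with none of them, a choice of
which `ρ` of the `r + ρ` edge names they carry, and a direction for each. The division is cleared by
the factor `ρ! r!`. -/
theorem sum_mult_eq {i j : Fin n} (hij : i ≠ j) (r ρ : ℕ) (F : VGraph n s → ℚ) :
    (ρ.factorial * r.factorial : ℚ) * ∑ f : Att n s (r + ρ),
      (if mult i j (mk ⟨r + ρ, f⟩) = ρ then F (mk ⟨r + ρ, f⟩) else 0) =
    2 ^ ρ * (r + ρ).factorial * ∑ f : Att n s r,
      (if mult i j (mk ⟨r, f⟩) = 0 then F ((addEdge i j)^[ρ] (mk ⟨r, f⟩)) else 0) := by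
  induction ρ generalizing F with
  | zero => simp
  | succ ρ ih =>
    -- One edge is removed: on the graphs selected by this function the multiplicity is the constant
    -- `ρ + 1`, and it is `ρ` once the edge is gone.
    have h := sum_mult_mul (m := r + ρ) i j fun H => if mult i j H = ρ + 1 then F H else 0
    have h' : ∀ f : Att n s (r + ρ + 1), (mult i j (mk ⟨r + ρ + 1, f⟩) : ℚ) *
        (if mult i j (mk ⟨r + ρ + 1, f⟩) = ρ + 1 then F (mk ⟨r + ρ + 1, f⟩) else 0) =
        (ρ + 1) * (if mult i j (mk ⟨r + ρ + 1, f⟩) = ρ + 1 then F (mk ⟨r + ρ + 1, f⟩) else 0) := by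
      intro f
      split_ifs with hf
      · rw [hf]; push_cast; ring
      · simp
    simp only [h', ← Finset.mul_sum, mult_addEdge hij, add_left_inj] at h
    have h2 := ih (fun H => F (addEdge i j H))
    simp only [← Function.iterate_succ_apply' (addEdge i j)] at h2
    change _ * (∑ f : Att n s (r + ρ + 1),
      if mult i j (mk ⟨r + ρ + 1, f⟩) = ρ + 1 then F (mk ⟨r + ρ + 1, f⟩) else 0) =
        2 ^ (ρ + 1) * ((r + ρ + 1).factorial : ℚ) * _
    rw [Nat.factorial_succ (r + ρ), Nat.factorial_succ ρ]
    push_cast at h h2 ⊢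
    calc _ = (ρ.factorial * r.factorial : ℚ) * ((ρ + 1) * ∑ f : Att n s (r + ρ + 1),
          if mult i j (mk ⟨r + ρ + 1, f⟩) = ρ + 1 then F (mk ⟨r + ρ + 1, f⟩) else 0) := by ring
      _ = 2 * (r + ρ + 1) * (2 ^ ρ * (r + ρ).factorial * ∑ f : Att n s r,
          if mult i j (mk ⟨r, f⟩) = 0 then F ((addEdge i j)^[ρ + 1] (mk ⟨r, f⟩)) else 0) := by
        rw [h, ← h2]; ring
      _ = _ := by ring

end VGraph

/-! ### Contraction as the inverse of splitting. -/

namespace RawGraph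

variable {n s : ℕ}

/-- The map identifying the last vertex with `v_i`. -/
def merge (i : Fin n) : Fin (n + 1) → Fin n := Fin.lastCases i id

@[simp] theorem merge_last (i : Fin n) : merge i (Fin.last n) = i := by simp [merge]

@[simp] theorem merge_castSucc (i j : Fin n) : merge i j.castSucc = j := by simp [merge]

theorem merge_eq_merge_iff (i : Fin n) (u v : Fin (n + 1)) :
    merge i u = merge i v ↔
      u = v ∨ (u = i.castSucc ∧ v = Fin.last n) ∨ (v = i.castSucc ∧ u = Fin.last n) := by
  induction u using Fin.lastCases with
  | last =>
    induction v using Fin.lastCases with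
    | last => simp
    | cast v => simp [(Fin.castSucc_lt_last _).ne, (Fin.castSucc_lt_last _).ne', eq_comm]
  | cast u =>
    induction v using Fin.lastCases with
    | last => simp [(Fin.castSucc_lt_last _).ne, (Fin.castSucc_lt_last _).ne']
    | cast v => simp [(Fin.castSucc_lt_last _).ne]

/-- The graph in which the last vertex is identified with `v_i`. -/
def contract (i : Fin n) (G : RawGraph (n + 1) s) : RawGraph n s := ⟨G.m, merge i ∘ G.att⟩

theorem mult_eq_zero_iff (i j : Fin n) (G : RawGraph n s) :
    G.mult i j = 0 ↔ ∀ a, ¬ (G.att (Sum.inl a) = i ∧ G.att (Sum.inl (flip a)) = j) := by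
  rw [mult, Finset.card_eq_zero, Finset.filter_eq_empty_iff]
  simp

theorem isLoopless_contract (i : Fin n) (G : RawGraph (n + 1) s) :
    (G.contract i).IsLoopless ↔ G.IsLoopless ∧ G.mult i.castSucc (Fin.last n) = 0 := by
  simp only [isLoopless_iff, mult_eq_zero_iff, ← forall_and]
  change (∀ a, merge i (G.att (Sum.inl a)) ≠ merge i (G.att (Sum.inl (flip a)))) ↔ _
  simp only [ne_eq, merge_eq_merge_iff]
  constructor
  · intro h a
    have := h a
    tauto
  · intro h a
    have h₁ := h a
    have h₂ := h (flip a)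
    rw [flip_flip] at h₂
    tauto

/-- Closed sets of the contraction correspond, by preimage under `merge i`, to closed sets that
contain both or neither of `v_i` and the last vertex. The latter are the closed sets after joining
these two by an edge. -/
theorem isConnected_contract (i : Fin n) (G : RawGraph (n + 1) s) (ρ : ℕ) :
    (G.contract i).IsConnected ↔
      ((addEdge i.castSucc (Fin.last n))^[ρ + 1] G).IsConnected := by
  simp only [isConnected_iff, isClosedSet_addEdge_iterate]
  constructor
  · rintro ⟨-, h⟩
    refine ⟨n.succ_pos, ?_⟩
    rintro S ⟨hS, hi⟩ u v hu
    have hm : ∀ w, w ∈ S ↔ (merge i w).castSucc ∈ S := by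
      intro w
      induction w using Fin.lastCases with
      | last => simp [hi]
      | cast w => simp
    rw [hm] at hu ⊢
    refine h {w | w.castSucc ∈ S} (fun a ha => ?_) _ _ hu
    exact (hm _).1 (hS a ((hm _).2 ha))
  · rintro ⟨-, h⟩
    refine ⟨i.pos, fun S hS u v hu => ?_⟩
    simpa using h (merge i ⁻¹' S) ⟨hS, by simp⟩ u.castSucc v.castSucc (by simpa using hu)

/-- The vanishing multiplicity is needed because an edge between the merged vertices becomes a loop.
It also makes the new edges the only ones between them, so their number can be read off the result.
-/
theorem isAdmissible_contract (i : Fin n) (G : RawGraph (n + 1) s) (ρ : ℕ) :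
    (G.contract i).IsAdmissible ↔
      ((addEdge i.castSucc (Fin.last n))^[ρ + 1] G).IsAdmissible ∧
        G.mult i.castSucc (Fin.last n) = 0 := by
  rw [IsAdmissible, IsAdmissible, isConnected_contract i G ρ, isLoopless_contract,
    isLoopless_addEdge_iterate (Fin.castSucc_lt_last i).ne]
  tauto

theorem mem_endsAt {G : RawGraph n s} {i : Fin n} {x : (Fin G.m × Fin 2) ⊕ Fin s} :
    x ∈ G.endsAt i ↔ G.att x = i := by
  simp [endsAt]

theorem split_att_of_mem {G : RawGraph n s} {A : Finset ((Fin G.m × Fin 2) ⊕ Fin s)}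
    {x : (Fin G.m × Fin 2) ⊕ Fin s} (hx : x ∈ A) : (G.split A).att x = Fin.last n :=
  if_pos hx

theorem split_att_of_notMem {G : RawGraph n s} {A : Finset ((Fin G.m × Fin 2) ⊕ Fin s)}
    {x : (Fin G.m × Fin 2) ⊕ Fin s} (hx : x ∉ A) : (G.split A).att x = (G.att x).castSucc :=
  if_neg hx

theorem contract_split (i : Fin n) (G : RawGraph n s) {A : Finset ((Fin G.m × Fin 2) ⊕ Fin s)}
    (hA : A ⊆ G.endsAt i) : (G.split A).contract i = G := by
  refine congrArg (RawGraph.mk G.m) (funext fun (x : (Fin G.m × Fin 2) ⊕ Fin s) => ?_)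
  by_cases hx : x ∈ A
  · exact (congrArg (merge i) (split_att_of_mem hx)).trans
      ((merge_last i).trans (mem_endsAt.1 (hA hx)).symm)
  · exact (congrArg (merge i) (split_att_of_notMem hx)).trans (merge_castSucc i _)

/-- The ends assigned to the last vertex. -/
def lastEnds (G : RawGraph (n + 1) s) : Finset ((Fin G.m × Fin 2) ⊕ Fin s) :=
  G.endsAt (Fin.last n)

theorem lastEnds_subset (i : Fin n) (G : RawGraph (n + 1) s) :
    G.lastEnds ⊆ (G.contract i).endsAt i := by
  intro x hx
  refine mem_endsAt.2 ?_
  change merge i (G.att x) = i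
  rw [mem_endsAt.1 hx, merge_last]

theorem split_contract (i : Fin n) (G : RawGraph (n + 1) s) :
    (G.contract i).split G.lastEnds = G := by
  refine congrArg (RawGraph.mk G.m) (funext fun (x : (Fin G.m × Fin 2) ⊕ Fin s) => ?_)
  by_cases hx : G.att x = Fin.last n
  · exact (if_pos (mem_endsAt.2 hx)).trans hx.symm
  · refine (if_neg (mt mem_endsAt.1 hx)).trans ?_
    obtain ⟨y, hy⟩ := Fin.exists_castSucc_eq.2 hx
    change (merge i (G.att x)).castSucc = G.att x
    rw [← hy, merge_castSucc]

theorem lastEnds_split (G : RawGraph n s) (A : Finset ((Fin G.m × Fin 2) ⊕ Fin s)) :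
    (G.split A).lastEnds = A := by
  refine Finset.ext fun (x : (Fin G.m × Fin 2) ⊕ Fin s) => mem_endsAt.trans ?_
  by_cases hx : x ∈ A
  · exact iff_of_true (split_att_of_mem hx) hx
  · refine iff_of_false (fun h => (Fin.castSucc_lt_last (G.att x)).ne ?_) hx
    exact (split_att_of_notMem hx).symm.trans h

end RawGraph

/-! ### Sums over splittings, and averaging the degree of the last vertex. -/

namespace VGraph

variable {n s : ℕ}

/-- Splittings of `v_i` correspond to graphs with one more vertex. -/
theorem sum_sum_split {r : ℕ} (i : Fin n) (g : RawGraph n s → RawGraph (n + 1) s → ℚ) :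
    ∑ f : Att n s r, ∑ A ∈ (RawGraph.endsAt ⟨r, f⟩ i).powerset,
      g ⟨r, f⟩ (RawGraph.split ⟨r, f⟩ A) =
    ∑ f : Att (n + 1) s r, g (RawGraph.contract i ⟨r, f⟩) ⟨r, f⟩ := by
  rw [Finset.sum_sigma']
  refine Finset.sum_bij'
    (i := fun p _ => (RawGraph.split ⟨r, p.1⟩ p.2).att)
    (j := fun f _ => ⟨(RawGraph.contract i ⟨r, f⟩).att, RawGraph.lastEnds ⟨r, f⟩⟩) ?_ ?_ ?_ ?_ ?_
  · exact fun _ _ => Finset.mem_univ _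
  · intro f _
    rw [Finset.mem_sigma, Finset.mem_powerset]
    exact ⟨Finset.mem_univ _, RawGraph.lastEnds_subset i ⟨r, f⟩⟩
  · rintro ⟨f, A⟩ hA
    rw [Finset.mem_sigma, Finset.mem_powerset] at hA
    have h₁ : (RawGraph.contract i (RawGraph.split ⟨r, f⟩ A)) = ⟨r, f⟩ :=
      RawGraph.contract_split i _ hA.2
    have h₂ := RawGraph.lastEnds_split ⟨r, f⟩ A
    refine Sigma.ext ?_ (heq_of_eq h₂)
    injection h₁
  · intro f _
    have h := RawGraph.split_contract i ⟨r, f⟩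
    injection h
  · rintro ⟨f, A⟩ hA
    rw [Finset.mem_sigma, Finset.mem_powerset] at hA
    have h₁ : (RawGraph.contract i (RawGraph.split ⟨r, f⟩ A)) = ⟨r, f⟩ :=
      RawGraph.contract_split i _ hA.2
    change g _ _ = g (RawGraph.contract i (RawGraph.split ⟨r, f⟩ A)) _
    rw [h₁]
    rfl

/-- Functions of graphs which take the same value on isomorphic graphs. -/
def IsInvariant (Λ : VGraph n s → ℚ) : Prop :=
  ∀ G H : RawGraph n s, Nonempty (RawGraph.Iso G H) → Λ (mk G) = Λ (mk H)

/-- Exchanging `u` and `v` permutes the assignments and leaves `Λ` unchanged, so all vertices have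
the same weighted total degree. -/
theorem sum_mult_mul_eq {Λ : VGraph n s → ℚ} (hΛ : IsInvariant Λ) (m : ℕ) (u v : Fin n) :
    ∑ f : Att n s m, ∑ i, (mult i u (mk ⟨m, f⟩) : ℚ) * Λ (mk ⟨m, f⟩) =
      ∑ f : Att n s m, ∑ i, (mult i v (mk ⟨m, f⟩) : ℚ) * Λ (mk ⟨m, f⟩) := by
  refine Fintype.sum_equiv (Equiv.arrowCongr (Equiv.refl _) (Equiv.swap u v)) _ _ fun f => ?_
  refine Fintype.sum_equiv (Equiv.swap u v) _ _ fun i => ?_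
  let φ : RawGraph.Iso ⟨m, f⟩ ⟨m, Equiv.arrowCongr (Equiv.refl _) (Equiv.swap u v) f⟩ :=
    RawGraph.Iso.ofFlip (G := ⟨m, f⟩)
      (H := ⟨m, Equiv.arrowCongr (Equiv.refl _) (Equiv.swap u v) f⟩) (Equiv.swap u v)
      (Equiv.refl _) (fun _ => rfl) (fun _ => rfl) (fun _ => rfl)
  have h := φ.mult_eq i u
  rw [hΛ _ _ ⟨φ⟩, mult_mk, mult_mk, ← h]
  congr 3
  exact (Equiv.swap_apply_left u v)

/-- Handshake lemma: every end is counted once, by its own vertex and the vertex of its partner. The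
diagonal terms count the ends of loops. -/
theorem sum_sum_mult {m : ℕ} (f : Att n s m) :
    ∑ j, ∑ i, (mult i j (mk ⟨m, f⟩)) = 2 * m := by
  simp only [mult_mk, RawGraph.mult_mk]
  have h : ∀ j, ∑ i, (∑ a, if f (Sum.inl a) = i ∧ f (Sum.inl (RawGraph.flip a)) = j then 1 else 0)
      = ∑ a, if f (Sum.inl (RawGraph.flip a)) = j then 1 else 0 := by
    intro j
    rw [Finset.sum_comm]
    refine Finset.sum_congr rfl fun a _ => ?_
    simp [ite_and]
  simp only [h]
  rw [Finset.sum_comm]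
  simp [mul_comm]

/-- The average of the degree of the last vertex. -/
theorem sum_mult_last {Λ : VGraph (n + 1) s → ℚ} (hΛ : IsInvariant Λ)
    (hΛ' : ∀ H ∉ admissible (n + 1) s, Λ H = 0) (m : ℕ) :
    (n + 1) * ∑ i : Fin n, ∑ f : Att (n + 1) s m,
      (mult i.castSucc (Fin.last n) (mk ⟨m, f⟩) : ℚ) * Λ (mk ⟨m, f⟩) =
    2 * m * ∑ f : Att (n + 1) s m, Λ (mk ⟨m, f⟩) := by
  have h₁ : ∑ i : Fin n, ∑ f : Att (n + 1) s m,
      (mult i.castSucc (Fin.last n) (mk ⟨m, f⟩) : ℚ) * Λ (mk ⟨m, f⟩) =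
      ∑ f : Att (n + 1) s m, ∑ i, (mult i (Fin.last n) (mk ⟨m, f⟩) : ℚ) * Λ (mk ⟨m, f⟩) := by
    rw [Finset.sum_comm]
    refine Finset.sum_congr rfl fun f _ => ?_
    -- The extra summand, with `i` the last vertex itself, counts ends of loops, so it vanishes
    -- wherever `Λ` does not.
    rw [Fin.sum_univ_castSucc, left_eq_add]
    by_cases hf : mk ⟨m, f⟩ ∈ admissible (n + 1) s
    · have hl := (mk_mem_admissible.1 hf).2
      rw [RawGraph.isLoopless_iff] at hl
      have : RawGraph.mult (Fin.last n) (Fin.last n) ⟨m, f⟩ = 0 := by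
        rw [RawGraph.mult_eq_zero_iff]
        exact fun a ha => hl a (ha.1.trans ha.2.symm)
      rw [mult_mk, this]
      simp
    · rw [hΛ' _ hf, mul_zero]
  rw [h₁]
  have h₂ : ∀ j : Fin (n + 1), _ := fun j => sum_mult_mul_eq hΛ m j (Fin.last n)
  have h₃ := Finset.sum_congr (rfl : (Finset.univ : Finset (Fin (n + 1))) = _) fun j _ => h₂ j
  rw [Finset.sum_const, Finset.card_univ, Fintype.card_fin, nsmul_eq_mul] at h₃
  push_cast at h₃
  rw [← h₃, Finset.sum_comm, Finset.mul_sum]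
  refine Finset.sum_congr rfl fun f _ => ?_
  simp only [← Finset.sum_mul]
  have := sum_sum_mult f
  rw [← Nat.cast_inj (R := ℚ)] at this
  push_cast at this
  rw [this]

end VGraph

/-! ### Renaming vertices. -/

namespace RawGraph

variable {n s : ℕ}

/-- Renaming the vertices. -/
def relabel (σ : Equiv.Perm (Fin n)) (G : RawGraph n s) : RawGraph n s := ⟨G.m, σ ∘ G.att⟩

/-- The isomorphism given by renaming the vertices. -/
def relabelIso (σ : Equiv.Perm (Fin n)) (G : RawGraph n s) : Iso G (G.relabel σ) :=
  Iso.ofFlip (H := G.relabel σ) σ (Equiv.refl _) (fun _ => rfl) (fun _ => rfl) (fun _ => rfl)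

/-- The permutation of `n + 1` vertices fixing the last one. -/
def extendPerm (σ : Equiv.Perm (Fin n)) : Equiv.Perm (Fin (n + 1)) :=
  (finSuccEquivLast.trans (Equiv.optionCongr σ)).trans finSuccEquivLast.symm

@[simp] theorem extendPerm_last (σ : Equiv.Perm (Fin n)) :
    extendPerm σ (Fin.last n) = Fin.last n := by
  simp [extendPerm]

@[simp] theorem extendPerm_castSucc (σ : Equiv.Perm (Fin n)) (i : Fin n) :
    extendPerm σ i.castSucc = (σ i).castSucc := by
  simp [extendPerm]

theorem relabel_addEdge (σ : Equiv.Perm (Fin n)) (i j : Fin n) (G : RawGraph n s) :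
    (G.addEdge i j).relabel σ = (G.relabel σ).addEdge (σ i) (σ j) := by
  refine congrArg (RawGraph.mk (G.m + 1)) (funext fun x => ?_)
  rcases x with ⟨e, b⟩ | z
  · induction e using Fin.lastCases with
    | last =>
      fin_cases b
      · exact (congrArg σ (extend_last_zero i j G.att)).trans (extend_last_zero _ _ _).symm
      · exact (congrArg σ (extend_last_one i j G.att)).trans (extend_last_one _ _ _).symm
    | cast e =>
      exact (congrArg σ (extend_castSucc i j G.att e b)).trans
        (extend_castSucc (σ i) (σ j) (G.relabel σ).att e b).symm
  · rfl

theorem relabel_addEdge_iterate (σ : Equiv.Perm (Fin n)) (i j : Fin n) (G : RawGraph n s)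
    (ρ : ℕ) :
    ((addEdge i j)^[ρ] G).relabel σ = (addEdge (σ i) (σ j))^[ρ] (G.relabel σ) := by
  induction ρ with
  | zero => rfl
  | succ ρ ih =>
    rw [Function.iterate_succ_apply', Function.iterate_succ_apply', relabel_addEdge, ih]

theorem split_relabel (σ : Equiv.Perm (Fin n)) (G : RawGraph n s)
    (A : Finset ((Fin G.m × Fin 2) ⊕ Fin s)) :
    (G.relabel σ).split A = (G.split A).relabel (extendPerm σ) := by
  refine congrArg (RawGraph.mk G.m) (funext fun (x : (Fin G.m × Fin 2) ⊕ Fin s) => ?_)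
  by_cases hx : x ∈ A
  · exact (if_pos hx).trans
      ((congrArg (extendPerm σ) (split_att_of_mem hx)).trans (extendPerm_last σ)).symm
  · exact (if_neg hx).trans
      ((congrArg (extendPerm σ) (split_att_of_notMem hx)).trans (extendPerm_castSucc σ _)).symm

theorem endsAt_relabel (σ : Equiv.Perm (Fin n)) (G : RawGraph n s) (i : Fin n) :
    (G.relabel σ).endsAt (σ i) = G.endsAt i := by
  refine Finset.ext fun (x : (Fin G.m × Fin 2) ⊕ Fin s) => ?_
  exact mem_endsAt.trans (σ.injective.eq_iff.trans mem_endsAt.symm)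

end RawGraph

/-! ### Invariant functions and their pullback along splitting. -/

namespace VGraph

variable {n s : ℕ}

/-- Every isomorphism is a renaming of the vertices followed by an isomorphism fixing them, and the
latter is invisible in `VGraph`. -/
theorem isInvariant_iff {Λ : VGraph n s → ℚ} :
    IsInvariant Λ ↔ ∀ σ G, Λ (mk (RawGraph.relabel σ G)) = Λ (mk G) := by
  constructor
  · exact fun h σ G => (h _ _ ⟨RawGraph.relabelIso σ G⟩).symm
  · rintro h G H ⟨φ⟩
    rw [← h φ.vertexEquiv G]
    refine congrArg Λ (mk_eq_mk (((RawGraph.relabelIso _ G).symm).trans φ) ?_)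
    ext1 v
    simp [RawGraph.Iso.trans, RawGraph.Iso.symm, RawGraph.relabelIso, RawGraph.Iso.ofFlip]

theorem l_pow_single (i j : Fin n) (ρ : ℕ) (H : VGraph n s) (c : ℚ) :
    (l i j ^ ρ) (Finsupp.single H c) = Finsupp.single ((addEdge i j)^[ρ] H) c := by
  induction ρ with
  | zero => rfl
  | succ ρ ih =>
    rw [pow_succ', Module.End.mul_apply, ih, Function.iterate_succ_apply', l,
      Finsupp.lmapDomain_apply, Finsupp.mapDomain_single]

/-- The linear map `l_{i,n+1}^ρ ∘ s_{𝓔_i}`. -/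
noncomputable def splitAdd (ρ : ℕ) (i : Fin n) :
    (VGraph n s →₀ ℚ) →ₗ[ℚ] (VGraph (n + 1) s →₀ ℚ) :=
  (l i.castSucc (Fin.last n) ^ ρ) ∘ₗ splitVertex i

theorem splitAdd_single (ρ : ℕ) (i : Fin n) (G : RawGraph n s) :
    splitAdd ρ i (Finsupp.single (mk G) 1) = ∑ A ∈ (G.endsAt i).powerset,
      Finsupp.single ((addEdge i.castSucc (Fin.last n))^[ρ] (mk (G.split A))) 1 := by
  have h : splitVertex i (Finsupp.single (mk G) (1 : ℚ)) = splitRaw i G := by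
    rw [splitVertex, Finsupp.linearCombination_single, one_smul]
    rfl
  rw [splitAdd, LinearMap.comp_apply, h, splitRaw, map_sum]
  exact Finset.sum_congr rfl fun A _ => l_pow_single _ _ _ _ _

/-- The function of graphs on `n` vertices obtained from one on `n + 1` vertices by summing over
all ways of splitting a vertex and joining the two resulting vertices by `ρ` edges. -/
noncomputable def pullback (ρ : ℕ) (Λ : VGraph (n + 1) s → ℚ) (H : VGraph n s) : ℚ :=
  ∑ i, Finsupp.linearCombination ℚ Λ (splitAdd ρ i (Finsupp.single H 1))

/-- `pullback` is the transpose of the sum over `i` of `splitAdd ρ i`; this moves the recursion for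
`thetaHat` onto the test function. -/
theorem linearCombination_pullback (ρ : ℕ) (Λ : VGraph (n + 1) s → ℚ) (θ : VGraph n s →₀ ℚ) :
    Finsupp.linearCombination ℚ (pullback ρ Λ) θ =
      ∑ i, Finsupp.linearCombination ℚ Λ (splitAdd ρ i θ) := by
  induction θ using Finsupp.induction_linear with
  | zero => simp
  | add f g hf hg => simp only [map_add, hf, hg, Finset.sum_add_distrib]
  | single H c =>
    rw [← mul_one c, ← smul_eq_mul, ← Finsupp.smul_single]
    simp only [map_smul, ← Finset.smul_sum]
    rw [Finsupp.linearCombination_single, one_smul, pullback]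

theorem pullback_mk (ρ : ℕ) (Λ : VGraph (n + 1) s → ℚ) (G : RawGraph n s) :
    pullback ρ Λ (mk G) = ∑ i, ∑ A ∈ (G.endsAt i).powerset,
      Λ ((addEdge i.castSucc (Fin.last n))^[ρ] (mk (G.split A))) := by
  simp only [pullback, splitAdd_single, map_sum, Finsupp.linearCombination_single, one_smul]

/-- Renaming by `σ` before splitting `v_{σ i}` amounts to splitting `v_i` and then renaming by the
extension of `σ` that fixes the new vertex. Summing over `i` absorbs the permutation. -/
theorem IsInvariant.pullback {Λ : VGraph (n + 1) s → ℚ} (hΛ : IsInvariant Λ) (ρ : ℕ) :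
    IsInvariant (pullback ρ Λ) := by
  rw [isInvariant_iff] at hΛ ⊢
  intro σ G
  rw [pullback_mk, pullback_mk, ← Equiv.sum_comp σ]
  refine Finset.sum_congr rfl fun i _ => ?_
  refine Finset.sum_congr (congrArg Finset.powerset (RawGraph.endsAt_relabel σ G i)) fun A _ => ?_
  rw [addEdge_iterate_mk, addEdge_iterate_mk,
    ← hΛ (RawGraph.extendPerm σ) ((RawGraph.addEdge i.castSucc (Fin.last n))^[ρ] (G.split A)),
    RawGraph.relabel_addEdge_iterate, RawGraph.extendPerm_castSucc, RawGraph.extendPerm_last]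
  exact congrArg (fun K => Λ (mk ((RawGraph.addEdge (σ i).castSucc (Fin.last n))^[ρ] K)))
    (RawGraph.split_relabel σ G A)

/-- The sum of the values of the pullback at admissible graphs. -/
theorem sum_pullback {Λ : VGraph (n + 1) s → ℚ} (hΛ : ∀ H ∉ admissible (n + 1) s, Λ H = 0)
    (r ρ : ℕ) :
    ((ρ + 1).factorial * r.factorial : ℚ) * ∑ i : Fin n, ∑ f : Att (n + 1) s (r + (ρ + 1)),
      (if mult i.castSucc (Fin.last n) (mk ⟨r + (ρ + 1), f⟩) = ρ + 1
        then Λ (mk ⟨r + (ρ + 1), f⟩) else 0) =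
    2 ^ (ρ + 1) * (r + (ρ + 1)).factorial * ∑ f : Att n s r,
      (admissible n s).indicator (pullback (ρ + 1) Λ) (mk ⟨r, f⟩) := by
  classical
  rw [Finset.mul_sum]
  simp only [sum_mult_eq (Fin.castSucc_lt_last _).ne]
  rw [← Finset.mul_sum]
  congr 1
  simp only [Set.indicator_apply, pullback_mk, mk_mem_admissible]
  have h : ∀ f : Att n s r, (if RawGraph.IsAdmissible ⟨r, f⟩ then
      ∑ i, ∑ A ∈ (RawGraph.endsAt ⟨r, f⟩ i).powerset,
        Λ ((addEdge i.castSucc (Fin.last n))^[ρ + 1] (mk (RawGraph.split ⟨r, f⟩ A))) else 0) =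
      ∑ i, ∑ A ∈ (RawGraph.endsAt ⟨r, f⟩ i).powerset,
        (fun (G : RawGraph n s) K => if G.IsAdmissible then
          Λ ((addEdge i.castSucc (Fin.last n))^[ρ + 1] (mk K)) else 0) ⟨r, f⟩
          (RawGraph.split ⟨r, f⟩ A) := by
    intro f
    by_cases hf : RawGraph.IsAdmissible ⟨r, f⟩
    · simp only [hf, if_true]
    · simp only [hf, if_false, Finset.sum_const_zero]
  simp only [h]
  refine Eq.trans ?_ Finset.sum_comm
  refine Finset.sum_congr rfl fun i _ => ?_
  refine Eq.trans ?_ (sum_sum_split i (fun (G : RawGraph n s) K => if G.IsAdmissible then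
    Λ ((addEdge i.castSucc (Fin.last n))^[ρ + 1] (mk K)) else 0)).symm
  refine Finset.sum_congr rfl fun f _ => ?_
  -- Admissibility of the contraction becomes the condition that there is no edge between the two
  -- vertices; its other half is implied wherever `Λ` is nonzero.
  simp only [RawGraph.isAdmissible_contract i _ ρ, mult_mk, addEdge_iterate_mk]
  by_cases h₁ : RawGraph.mult i.castSucc (Fin.last n) ⟨r, f⟩ = 0
  · by_cases h₂ : ((RawGraph.addEdge i.castSucc (Fin.last n))^[ρ + 1]
        (⟨r, f⟩ : RawGraph (n + 1) s)).IsAdmissible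
    · simp only [h₁, h₂, and_self, if_true]
    · rw [hΛ _ (mt mk_mem_admissible.1 h₂), ite_self, ite_self]
  · simp [h₁]

end VGraph

/-! ### Orbit-stabilizer: counting the assignments in an isomorphism class. -/

namespace RawGraph

variable {n s : ℕ}

theorem Iso.ext {G H : RawGraph n s} {φ χ : Iso G H} (h₁ : φ.vertexEquiv = χ.vertexEquiv)
    (h₂ : φ.endEquiv = χ.endEquiv) : φ = χ := by
  cases φ
  cases χ
  cases h₁
  cases h₂
  rfl

instance (G H : RawGraph n s) : Finite (Iso G H) :=
  Finite.of_injective (fun φ => (φ.vertexEquiv, φ.endEquiv)) fun _ _ h =>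
    Iso.ext (congrArg Prod.fst h) (congrArg Prod.snd h)

theorem symmetryFactor_pos (G : RawGraph n s) : 0 < G.symmetryFactor :=
  @Nat.card_pos _ ⟨Iso.refl G⟩ _

/-- If two graphs are isomorphic, there are as many isomorphisms as automorphisms. -/
theorem Iso.card_eq {G H : RawGraph n s} (φ : Iso G H) : Nat.card (Iso G H) = G.symmetryFactor :=
  Nat.card_congr
    { toFun := fun χ => χ.trans φ.symm
      invFun := fun χ => χ.trans φ
      left_inv := fun χ => Iso.ext (by ext1 v; simp [trans, symm]) (by ext1 v; simp [trans, symm])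
      right_inv := fun χ =>
        Iso.ext (by ext1 v; simp [trans, symm]) (by ext1 v; simp [trans, symm]) }

/-- The permutations of the ends of internal edges which map edges to edges. -/
abbrev EndPerm (m : ℕ) : Type :=
  {ε : Equiv.Perm (Fin m × Fin 2) // ∀ a, ε (flip a) = flip (ε a)}

/-- Permuting the edges, and the two ends of each edge. -/
def endPermOf {m : ℕ} (p : Equiv.Perm (Fin m) × (Fin m → Equiv.Perm (Fin 2))) : EndPerm m :=
  ⟨(Equiv.prodShear p.1 p.2), fun a => Prod.ext rfl (perm_fin_two_rev (p.2 a.1) a.2)⟩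

/-- The permutations commuting with `flip` form the wreath product of the symmetric group on the
edges with the symmetric group on the two ends, hence the order `m! 2^m`. -/
theorem endPermOf_bijective (m : ℕ) : Function.Bijective (endPermOf (m := m)) := by
  constructor
  · rintro ⟨σ, τ⟩ ⟨σ', τ'⟩ h
    have h' : ∀ e b, (σ e, τ e b) = (σ' e, τ' e b) := fun e b =>
      congrArg (fun ε : EndPerm m => ε.1 (e, b)) h
    refine Prod.ext (Equiv.ext fun e => congrArg Prod.fst (h' e 0)) ?_
    exact funext fun e => Equiv.ext fun b => congrArg Prod.snd (h' e b)
  · rintro ⟨ε, hε⟩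
    have h₁ : ∀ a b : Fin m × Fin 2, a.1 = b.1 → (ε a).1 = (ε b).1 := by
      intro a b hab
      by_cases h : a = b
      · rw [h]
      · rw [eq_flip hab h, hε, flip_fst]
    have h₂ : ∀ a b : Fin m × Fin 2, (ε a).1 = (ε b).1 → a.1 = b.1 := by
      intro a b hab
      by_cases h : a = b
      · rw [h]
      · have := eq_flip hab fun h' => h (ε.injective h')
        rw [← hε, ε.injective.eq_iff] at this
        rw [this, flip_fst]
    have hσ : Function.Injective fun e => (ε (e, 0)).1 := fun e e' h => h₂ (e, 0) (e', 0) h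
    have hτ : ∀ e, Function.Injective fun b => (ε (e, b)).2 := by
      intro e b b' h
      have : ε (e, b) = ε (e, b') := Prod.ext (h₁ _ _ rfl) h
      exact congrArg Prod.snd (ε.injective this)
    refine ⟨(Equiv.ofBijective _ (Finite.injective_iff_bijective.1 hσ),
      fun e => Equiv.ofBijective _ (Finite.injective_iff_bijective.1 (hτ e))), ?_⟩
    refine Subtype.ext (Equiv.ext fun a => ?_)
    exact Prod.ext (h₁ (a.1, 0) a rfl) rfl

theorem card_endPerm (m : ℕ) : Nat.card (EndPerm m) = m.factorial * 2 ^ m := by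
  rw [← Nat.card_congr (Equiv.ofBijective _ (endPermOf_bijective m)), Nat.card_eq_fintype_card]
  simp [Fintype.card_perm]

/-- All the graphs isomorphic to a given one, with the isomorphisms, correspond to permutations of
the vertices and of the ends. -/
theorem sum_card_iso (G : RawGraph n s) :
    ∑ f : VGraph.Att n s G.m, Nat.card (Iso G ⟨G.m, f⟩) =
      n.factorial * (G.m.factorial * 2 ^ G.m) := by
  rw [← Nat.card_sigma, ← card_endPerm]
  have hn : n.factorial = Nat.card (Equiv.Perm (Fin n)) := by
    rw [Nat.card_eq_fintype_card, Fintype.card_perm, Fintype.card_fin]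
  rw [hn, ← Nat.card_prod]
  refine Nat.card_congr (Equiv.ofBijective (fun p : Σ f : VGraph.Att n s G.m, Iso G ⟨G.m, f⟩ =>
    ((p.2.vertexEquiv, ⟨p.2.endEquiv, p.2.endEquiv_flip⟩) : Equiv.Perm (Fin n) × EndPerm G.m))
    ⟨?_, ?_⟩)
  · rintro ⟨f, φ⟩ ⟨g, χ⟩ h
    have h₁ : φ.vertexEquiv = χ.vertexEquiv := congrArg Prod.fst h
    have h₂ : φ.endEquiv = χ.endEquiv := congrArg (fun q => q.2.1) h
    -- The target is recovered from the isomorphism: its assignment is the original one transported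
    -- along the two bijections.
    have hfg : f = g := by
      funext x
      rcases x with a | z
      · obtain ⟨a, rfl⟩ := φ.endEquiv.surjective a
        have e₁ := φ.att_int a
        have e₂ := χ.att_int a
        rw [← h₁, ← h₂] at e₂
        exact e₁.trans e₂.symm
      · have e₁ := φ.att_ext z
        have e₂ := χ.att_ext z
        rw [← h₁] at e₂
        exact e₁.trans e₂.symm
    subst hfg
    rw [Iso.ext h₁ h₂]
  · rintro ⟨σ, ε, hε⟩
    refine ⟨⟨σ ∘ G.att ∘ (Equiv.sumCongr ε (Equiv.refl _)).symm,
      Iso.ofFlip (H := ⟨G.m, σ ∘ G.att ∘ (Equiv.sumCongr ε (Equiv.refl _)).symm⟩) σ ε hε ?_ ?_⟩,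
      rfl⟩
    · intro a
      exact congrArg (fun x => σ (G.att (Sum.inl x))) (ε.symm_apply_apply a)
    · exact fun _ => rfl

end RawGraph

namespace VGraph

variable {n s : ℕ}

theorem mk_mem_isoClass {G H : RawGraph n s} :
    mk H ∈ isoClass G ↔ Nonempty (RawGraph.Iso G H) := by
  constructor
  · rintro ⟨K, ⟨φ⟩, h⟩
    obtain ⟨χ, -⟩ := exists_iso_of_mk_eq h
    exact ⟨φ.trans χ⟩
  · exact fun h => ⟨H, h, rfl⟩

/-- Each assignment isomorphic to `G` receives exactly `symmetryFactor` isomorphisms from `G`, and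
all of these together are the pairs of a vertex permutation and an edge-preserving end permutation.
-/
theorem sum_indicator_isoClass (G : RawGraph n s) :
    (∑ f : Att n s G.m, (isoClass G).indicator 1 (mk ⟨G.m, f⟩) : ℚ) * G.symmetryFactor =
      n.factorial * G.m.factorial * 2 ^ G.m := by
  classical
  have h := G.sum_card_iso
  rw [← Nat.cast_inj (R := ℚ)] at h
  push_cast at h
  rw [mul_assoc, ← h, Finset.sum_mul]
  refine Finset.sum_congr rfl fun f _ => ?_
  rw [Set.indicator_apply]
  split_ifs with hf
  · obtain ⟨φ⟩ := mk_mem_isoClass.1 hf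
    rw [φ.card_eq]
    simp
  · have : IsEmpty (RawGraph.Iso G ⟨G.m, f⟩) := not_nonempty_iff.1 (mt mk_mem_isoClass.2 hf)
    simp

/-! ### Support and positivity of the coefficients. -/

/-- The coefficients of the image under a linear map. -/
theorem linearMap_apply_eq_sum {α β : Type*} (T : (α →₀ ℚ) →ₗ[ℚ] (β →₀ ℚ)) (θ : α →₀ ℚ) (b : β) :
    T θ b = ∑ a ∈ θ.support, θ a * T (Finsupp.single a 1) b := by
  conv_lhs => rw [← Finsupp.sum_single θ, Finsupp.sum, map_sum, Finsupp.finsetSum_apply]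
  refine Finset.sum_congr rfl fun a _ => ?_
  rw [← mul_one (θ a), ← smul_eq_mul, ← Finsupp.smul_single, map_smul, Finsupp.smul_apply,
    smul_eq_mul, smul_eq_mul, mul_one]

theorem splitAdd_single_nonneg (ρ : ℕ) (i : Fin n) (G : VGraph n s) (H : VGraph (n + 1) s) :
    0 ≤ splitAdd ρ i (Finsupp.single G 1) H := by
  classical
  induction G using Quotient.inductionOn with
  | h G =>
    change 0 ≤ splitAdd ρ i (Finsupp.single (mk G) 1) H
    rw [splitAdd_single, Finsupp.finsetSum_apply]
    refine Finset.sum_nonneg fun A _ => ?_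
    rw [Finsupp.single_apply]
    split_ifs <;> norm_num

theorem splitAdd_nonneg (ρ : ℕ) (i : Fin n) {θ : VGraph n s →₀ ℚ} (hθ : ∀ G, 0 ≤ θ G)
    (H : VGraph (n + 1) s) : 0 ≤ splitAdd ρ i θ H := by
  rw [linearMap_apply_eq_sum]
  exact Finset.sum_nonneg fun G _ => mul_nonneg (hθ G) (splitAdd_single_nonneg ρ i G H)

theorem exists_of_splitAdd_ne_zero {ρ : ℕ} {i : Fin n} {θ : VGraph n s →₀ ℚ}
    {H : VGraph (n + 1) s} (h : splitAdd ρ i θ H ≠ 0) :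
    ∃ K : RawGraph (n + 1) s, θ (mk (K.contract i)) ≠ 0 ∧
      H = (addEdge i.castSucc (Fin.last n))^[ρ] (mk K) := by
  classical
  rw [linearMap_apply_eq_sum] at h
  obtain ⟨G, -, hG⟩ := Finset.exists_ne_zero_of_sum_ne_zero h
  obtain ⟨h₁, h₂⟩ := mul_ne_zero_iff.1 hG
  induction G using Quotient.inductionOn with
  | h G =>
    change splitAdd ρ i (Finsupp.single (mk G) 1) H ≠ 0 at h₂
    rw [splitAdd_single, Finsupp.finsetSum_apply] at h₂
    obtain ⟨A, hA, hA'⟩ := Finset.exists_ne_zero_of_sum_ne_zero h₂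
    refine ⟨G.split A, ?_, ?_⟩
    · rw [RawGraph.contract_split i G (Finset.mem_powerset.1 hA)]
      exact h₁
    · rw [Finsupp.single_apply] at hA'
      by_contra hne
      exact hA' (if_neg (Ne.symm hne))

theorem splitAdd_pos (ρ : ℕ) (i : Fin n) {θ : VGraph n s →₀ ℚ} (hθ : ∀ G, 0 ≤ θ G)
    {K : RawGraph (n + 1) s} (hK : 0 < θ (mk (K.contract i))) :
    0 < splitAdd ρ i θ ((addEdge i.castSucc (Fin.last n))^[ρ] (mk K)) := by
  classical
  rw [linearMap_apply_eq_sum]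
  refine Finset.sum_pos' (fun G _ => mul_nonneg (hθ G) (splitAdd_single_nonneg ρ i G _))
    ⟨mk (K.contract i), Finsupp.mem_support_iff.2 hK.ne', mul_pos hK ?_⟩
  rw [splitAdd_single, Finsupp.finsetSum_apply]
  refine Finset.sum_pos' (fun A _ => ?_) ⟨K.lastEnds,
    Finset.mem_powerset.2 (K.lastEnds_subset i), ?_⟩
  · rw [Finsupp.single_apply]
    split_ifs <;> norm_num
  · rw [K.split_contract i, Finsupp.single_eq_same]
    exact one_pos

/-- The index is shifted to `ρ + 1`, so that `(ρ - 1)!` becomes `ρ!` and the remaining cyclomatic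
number is `k - ρ` with `ρ ≤ k`. -/
theorem thetaHat_add_two (s n k : ℕ) :
    thetaHat s (n + 2) k = (1 / ((k + n + 1 : ℕ) : ℚ)) • ∑ ρ ∈ Finset.range (k + 1),
      ∑ i : Fin (n + 1),
        (1 / (2 * (ρ.factorial : ℚ))) • splitAdd (ρ + 1) i (thetaHat s (n + 1) (k - ρ)) := by
  rw [thetaHat]
  congr 1
  · push_cast
    ring
  · rw [Finset.range_eq_Ico]
    refine (Finset.sum_Ico_add' (fun ρ => ∑ i : Fin (n + 1),
      q ρ i (thetaHat s (n + 1) (k + 1 - ρ))) 0 (k + 1) 1).symm.trans ?_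
    refine Finset.sum_congr rfl fun ρ _ => Finset.sum_congr rfl fun i _ => ?_
    rw [q, Nat.add_sub_cancel, Nat.add_sub_add_right]
    rfl

/-- One vertex and `ρ + 1` edges are added, so the cyclomatic number grows by `ρ`. -/
theorem mk_mem_loopless_of_contract {k ρ : ℕ} {i : Fin n} {K : RawGraph (n + 1) s}
    (h : mk (K.contract i) ∈ loopless n k s) :
    (addEdge i.castSucc (Fin.last n))^[ρ + 1] (mk K) ∈ loopless (n + 1) (k + ρ) s := by
  rw [mk_mem_loopless] at h
  rw [addEdge_iterate_mk, mk_mem_loopless, RawGraph.m_addEdge_iterate]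
  refine ⟨((RawGraph.isAdmissible_contract i K ρ).1 h.1).1, ?_⟩
  have : K.m + 1 = n + k := h.2
  omega

theorem eq_mk_zero_of_vertex (G : RawGraph 1 s) (h : G.m = 0) : mk G = singleVertex s := by
  obtain ⟨m, f⟩ := G
  obtain rfl : m = 0 := h
  exact congrArg (fun g => mk ⟨0, g⟩) (Subsingleton.elim _ _)

theorem isAdmissible_singleVertex : RawGraph.IsAdmissible (⟨0, fun _ => 0⟩ : RawGraph 1 s) := by
  refine ⟨?_, fun e => e.elim0⟩
  rw [RawGraph.isConnected_iff]
  exact ⟨one_pos, fun S _ u v hu => by rwa [Subsingleton.elim v u]⟩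

theorem thetaHat_mem_loopless (s n k : ℕ) (H : VGraph n s) (h : thetaHat s n k H ≠ 0) :
    H ∈ loopless n k s := by
  classical
  obtain _ | n := n
  · exact absurd rfl h
  induction n generalizing k with
  | zero =>
    by_cases hk : k = 0
    · subst hk
      change (Finsupp.single (singleVertex s) (1 : ℚ)) H ≠ 0 at h
      rw [Finsupp.single_apply, ne_eq, ite_eq_right_iff, not_forall] at h
      obtain ⟨rfl, -⟩ := h
      exact mk_mem_loopless.2 ⟨isAdmissible_singleVertex, rfl⟩
    · rw [thetaHat, if_neg hk] at h
      exact absurd rfl h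
  | succ n ih =>
    rw [thetaHat_add_two, Finsupp.smul_apply, Finsupp.finsetSum_apply] at h
    obtain ⟨ρ, hρ, h₁⟩ := Finset.exists_ne_zero_of_sum_ne_zero (right_ne_zero_of_smul h)
    rw [Finsupp.finsetSum_apply] at h₁
    obtain ⟨i, -, h₂⟩ := Finset.exists_ne_zero_of_sum_ne_zero h₁
    rw [Finsupp.smul_apply] at h₂
    obtain ⟨K, hK, rfl⟩ := exists_of_splitAdd_ne_zero (right_ne_zero_of_smul h₂)
    have := mk_mem_loopless_of_contract (ρ := ρ) (ih _ _ hK)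
    rwa [Nat.sub_add_cancel (Finset.mem_range_succ_iff.1 hρ)] at this

theorem thetaHat_nonneg (s n k : ℕ) (H : VGraph n s) : 0 ≤ thetaHat s n k H := by
  classical
  obtain _ | n := n
  · exact le_rfl
  induction n generalizing k with
  | zero =>
    rw [thetaHat]
    split_ifs
    · rw [Finsupp.single_apply]
      split_ifs <;> norm_num
    · exact le_rfl
  | succ n ih =>
    rw [thetaHat_add_two, Finsupp.smul_apply, Finsupp.finsetSum_apply]
    refine mul_nonneg (by positivity) (Finset.sum_nonneg fun ρ _ => ?_)
    rw [Finsupp.finsetSum_apply]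
    refine Finset.sum_nonneg fun i _ => ?_
    rw [Finsupp.smul_apply]
    exact mul_nonneg (by positivity) (splitAdd_nonneg _ i (ih _) H)

/-- Otherwise the last vertex alone would form a closed set, while another vertex exists. -/
theorem exists_mult_pos {G : RawGraph (n + 2) s} (h : G.IsConnected) :
    ∃ i : Fin (n + 1), 0 < G.mult i.castSucc (Fin.last (n + 1)) := by
  by_contra! h0
  rw [RawGraph.isConnected_iff] at h
  refine (Fin.castSucc_lt_last (0 : Fin (n + 1))).ne ?_
  refine h.2 {Fin.last (n + 1)} (fun a ha => ?_) (Fin.last (n + 1)) _ rfl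
  by_contra hne
  obtain ⟨i, hi⟩ := Fin.exists_castSucc_eq.2 hne
  have := (RawGraph.mult_eq_zero_iff _ _ _).1 (Nat.le_zero.1 (h0 i)) (RawGraph.flip a)
  rw [RawGraph.flip_flip] at this
  exact this ⟨hi.symm, ha⟩

/-- An admissible graph in which the last vertex is connected to `v_i` arises from an admissible
graph with one vertex less. -/
theorem exists_contract {k ρ : ℕ} {i : Fin n} {G : RawGraph (n + 1) s}
    (hG : mk G ∈ loopless (n + 1) k s) (hρ : G.mult i.castSucc (Fin.last n) = ρ + 1) :
    ∃ K : RawGraph (n + 1) s, mk G = (addEdge i.castSucc (Fin.last n))^[ρ + 1] (mk K) ∧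
      ρ ≤ k ∧ mk (K.contract i) ∈ loopless n (k - ρ) s := by
  obtain ⟨K, hK, h0⟩ := exists_eq_addEdge_iterate (Fin.castSucc_lt_last i).ne _ hρ
  rw [hK, addEdge_iterate_mk, mk_mem_loopless, RawGraph.m_addEdge_iterate] at hG
  have hc := (RawGraph.isAdmissible_contract i K ρ).2 ⟨hG.1, h0⟩
  have := hc.1.cyclomaticNumber_add
  have hm : (K.contract i).m = K.m := rfl
  exact ⟨K, hK, by omega, mk_mem_loopless.2 ⟨hc, by omega⟩⟩

/-- All summands of the recursion are nonnegative, so one positive summand suffices: the one that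
contracts all edges between the last vertex and one of its neighbours. -/
theorem thetaHat_pos (s n k : ℕ) (hn : 1 ≤ n) (H : VGraph n s) (h : H ∈ loopless n k s) :
    0 < thetaHat s n k H := by
  classical
  obtain ⟨n, rfl⟩ := Nat.exists_eq_add_of_le' hn
  induction n generalizing k with
  | zero =>
    obtain ⟨G, hG, rfl⟩ := h
    obtain ⟨hA, hm⟩ := mk_mem_loopless.1 (⟨G, hG, rfl⟩ : mk G ∈ loopless (0 + 1) k s)
    have hm0 : G.m = 0 := by
      by_contra hne
      exact hA.2 ⟨0, Nat.pos_of_ne_zero hne⟩ (Subsingleton.elim (α := Fin 1) _ _)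
    obtain rfl : k = 0 := by omega
    change 0 < Finsupp.single (singleVertex s) (1 : ℚ) (mk G)
    rw [eq_mk_zero_of_vertex G hm0, Finsupp.single_eq_same]
    exact one_pos
  | succ n ih =>
    obtain ⟨G, hG, rfl⟩ := h
    obtain ⟨i, hi⟩ := exists_mult_pos hG.1
    obtain ⟨ρ, hρ⟩ := Nat.exists_eq_add_of_le' hi
    obtain ⟨K, hK, hk, hc⟩ := exists_contract ⟨G, hG, rfl⟩ hρ
    rw [hK, thetaHat_add_two, Finsupp.smul_apply, Finsupp.finsetSum_apply]
    refine mul_pos (by positivity) ?_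
    have h₁ : ∀ ρ (i : Fin (n + 1)) H, 0 ≤ ((1 / (2 * (ρ.factorial : ℚ))) •
        splitAdd (ρ + 1) i (thetaHat s (n + 1) (k - ρ))) H := fun ρ i H =>
      mul_nonneg (by positivity) (splitAdd_nonneg _ i (thetaHat_nonneg s _ _) H)
    refine Finset.sum_pos' (fun ρ _ => ?_) ⟨ρ, Finset.mem_range_succ_iff.2 hk, ?_⟩
    · rw [Finsupp.finsetSum_apply]
      exact Finset.sum_nonneg fun i _ => h₁ ρ i _
    · rw [Finsupp.finsetSum_apply]
      refine Finset.sum_pos' (fun i _ => h₁ ρ i _) ⟨i, Finset.mem_univ _, ?_⟩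
      exact mul_pos (by positivity)
        (splitAdd_pos _ i (thetaHat_nonneg s _ _) (ih _ (Nat.le_add_left _ _) _ hc))

end VGraph

/-! ### Pairing `thetaHat` with invariant functions. -/

namespace VGraph

variable {n s : ℕ}

theorem IsInvariant.indicator_admissible {Λ : VGraph n s → ℚ} (hΛ : IsInvariant Λ) :
    IsInvariant ((admissible n s).indicator Λ) := by
  classical
  rintro G H ⟨φ⟩
  simp only [Set.indicator_apply, mk_mem_admissible, φ.isAdmissible_iff, hΛ G H ⟨φ⟩]

theorem loopless_subset_admissible (n k s : ℕ) : loopless n k s ⊆ admissible n s := by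
  rintro _ ⟨G, h, rfl⟩
  exact ⟨G, ⟨h.1, h.2.1⟩, rfl⟩

theorem linearCombination_indicator (Λ : VGraph n s → ℚ) (k : ℕ) :
    Finsupp.linearCombination ℚ ((admissible n s).indicator Λ) (thetaHat s n k) =
      Finsupp.linearCombination ℚ Λ (thetaHat s n k) := by
  rw [Finsupp.linearCombination_apply, Finsupp.linearCombination_apply]
  refine Finset.sum_congr rfl fun H hH => ?_
  refine congrArg (_ • ·) (Set.indicator_of_mem ?_ _)
  exact loopless_subset_admissible n k s
    (thetaHat_mem_loopless s n k H (Finsupp.mem_support_iff.1 hH))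

/-- At most one term survives, and the range is long enough: with `k + n` edges on `n + 1` vertices,
connectedness of the contraction bounds every multiplicity with the last vertex by `k + 1`. -/
theorem sum_succ_mul_ite {Λ : VGraph (n + 1) s → ℚ} (hΛ : ∀ H ∉ admissible (n + 1) s, Λ H = 0)
    {k : ℕ} {G : RawGraph (n + 1) s} (hm : G.m = k + n) (i : Fin n) :
    ∑ ρ ∈ Finset.range (k + 1), (ρ + 1 : ℚ) *
      (if mult i.castSucc (Fin.last n) (mk G) = ρ + 1 then Λ (mk G) else 0) =
    mult i.castSucc (Fin.last n) (mk G) * Λ (mk G) := by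
  by_cases hG : mk G ∈ admissible (n + 1) s
  · obtain h0 | hpos := Nat.eq_zero_or_pos (mult i.castSucc (Fin.last n) (mk G))
    · rw [h0, Nat.cast_zero, zero_mul]
      exact Finset.sum_eq_zero fun ρ _ => by rw [if_neg (Nat.succ_ne_zero ρ).symm, mul_zero]
    · obtain ⟨ρ, hρ⟩ := Nat.exists_eq_add_of_le' hpos
      obtain ⟨-, -, hk, -⟩ := exists_contract (k := k) (mk_mem_loopless.2
        ⟨mk_mem_admissible.1 hG, by omega⟩) hρ
      rw [Finset.sum_eq_single_of_mem ρ (Finset.mem_range_succ_iff.2 hk), hρ, if_pos rfl]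
      · push_cast
        ring
      · intro ρ' _ hne
        rw [hρ, if_neg (by omega), mul_zero]
  · simp [hΛ _ hG]

/-- Invariant functions have the same sum over `thetaHat` as over all graphs with labelled ends,
up to normalization. -/
theorem linearCombination_thetaHat (s n k m : ℕ) (hm : m + 1 = (n + 1) + k)
    {Λ : VGraph (n + 1) s → ℚ} (hΛ : IsInvariant Λ) :
    (n + 1).factorial * m.factorial * 2 ^ m *
      Finsupp.linearCombination ℚ Λ (thetaHat s (n + 1) k) =
    ∑ f : Att (n + 1) s m, (admissible (n + 1) s).indicator Λ (mk ⟨m, f⟩) := by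
  induction n generalizing k m with
  | zero =>
    obtain rfl : m = k := by omega
    by_cases hk : m = 0
    · subst hk
      have h : ∀ f : Att 1 s 0, (admissible 1 s).indicator Λ (mk ⟨0, f⟩) = Λ (singleVertex s) := by
        intro f
        rw [eq_mk_zero_of_vertex ⟨0, f⟩ rfl, Set.indicator_of_mem]
        exact mk_mem_admissible.2 isAdmissible_singleVertex
      rw [Finset.sum_congr rfl fun f _ => h f]
      simp [thetaHat]
    · rw [thetaHat, if_neg hk, map_zero, mul_zero]
      refine (Finset.sum_eq_zero fun f _ => Set.indicator_of_notMem (fun hf => ?_) _).symm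
      exact (mk_mem_admissible.1 hf).2 ⟨0, Nat.pos_of_ne_zero hk⟩
        (Subsingleton.elim (α := Fin 1) _ _)
  | succ n ih =>
    obtain rfl : m = k + n + 1 := by omega
    rw [← linearCombination_indicator]
    have hinv := hΛ.indicator_admissible
    have hzero : ∀ H ∉ admissible (n + 2) s, (admissible (n + 2) s).indicator Λ H = 0 :=
      fun H hH => Set.indicator_of_notMem hH _
    -- Only invariance and vanishing off admissible graphs matter from here on; `thetaHat` does not
    -- see the difference, being supported on admissible graphs.
    generalize (admissible (n + 2) s).indicator Λ = Λ₀ at hinv hzero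
    have term : ∀ ρ ∈ Finset.range (k + 1),
        (2 * (n + 1).factorial * (k + n + 1).factorial * 2 ^ (k + n + 1) : ℚ) *
          ((1 / (2 * (ρ.factorial : ℚ))) * ∑ i : Fin (n + 1), Finsupp.linearCombination ℚ Λ₀
            (splitAdd (ρ + 1) i (thetaHat s (n + 1) (k - ρ)))) =
        ∑ i : Fin (n + 1), ∑ f : Att (n + 2) s (k + n + 1), (ρ + 1 : ℚ) *
          (if mult i.castSucc (Fin.last (n + 1)) (mk ⟨k + n + 1, f⟩) = ρ + 1
            then Λ₀ (mk ⟨k + n + 1, f⟩) else 0) := by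
      intro ρ hρ
      -- `r` is the number of edges left after the `ρ + 1` edges to the last vertex are removed,
      -- which is the edge count of the graphs in `thetaHat s (n + 1) (k - ρ)`.
      obtain ⟨r, hr⟩ : ∃ r, k + n + 1 = r + (ρ + 1) :=
        ⟨k + n - ρ, by have := Finset.mem_range_succ_iff.1 hρ; omega⟩
      have hρk := Finset.mem_range_succ_iff.1 hρ
      have h₁ := ih (k - ρ) r (by omega) (hinv.pullback (ρ + 1))
      have h₂ := sum_pullback hzero r ρ
      rw [linearCombination_pullback] at h₁
      rw [hr]
      simp only [← Finset.mul_sum]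
      rw [← h₁, Nat.factorial_succ ρ] at h₂
      have hr0 : (r.factorial : ℚ) ≠ 0 := by positivity
      have hρ0 : (ρ.factorial : ℚ) ≠ 0 := by positivity
      refine mul_left_cancel₀ (mul_ne_zero hr0 hρ0) ?_
      push_cast at h₂
      generalize (∑ i : Fin (n + 1), Finsupp.linearCombination ℚ Λ₀
            (splitAdd (ρ + 1) i (thetaHat s (n + 1) (k - ρ)))) = X at h₂ ⊢
      rw [mul_comm (r.factorial : ℚ), mul_assoc, mul_assoc (ρ.factorial : ℚ)]
      have h₃ : ∀ Y : ℚ, (ρ.factorial : ℚ) * (r.factorial * ((ρ + 1) * Y)) =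
          (ρ + 1) * ρ.factorial * r.factorial * Y := fun Y => by ring
      rw [h₃, h₂, pow_add 2 r (ρ + 1)]
      field_simp
    have hsum : (2 * (n + 1).factorial * (k + n + 1).factorial * 2 ^ (k + n + 1) : ℚ) *
        ((k + n + 1 : ℕ) * Finsupp.linearCombination ℚ Λ₀ (thetaHat s (n + 2) k)) =
        ∑ i : Fin (n + 1), ∑ f : Att (n + 2) s (k + n + 1),
          mult i.castSucc (Fin.last (n + 1)) (mk ⟨k + n + 1, f⟩) * Λ₀ (mk ⟨k + n + 1, f⟩) := by
      have hk0 : ((k + n + 1 : ℕ) : ℚ) ≠ 0 := by positivity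
      rw [thetaHat_add_two, map_smul, smul_eq_mul, ← mul_assoc ((k + n + 1 : ℕ) : ℚ),
        mul_one_div_cancel hk0, one_mul]
      simp only [map_sum, map_smul, smul_eq_mul, ← Finset.mul_sum]
      rw [Finset.mul_sum, Finset.sum_congr rfl term, Finset.sum_comm]
      refine Finset.sum_congr rfl fun i _ => ?_
      rw [Finset.sum_comm]
      refine Finset.sum_congr rfl fun f _ => ?_
      exact sum_succ_mul_ite hzero (G := ⟨k + n + 1, f⟩) (by simp [add_assoc]) i
    -- The edge count `k + n + 1` in the handshake total `2m` is also the denominator of the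
    -- recursion, so it cancels. The number `n + 2` of vertices turns `(n + 1)!` into `(n + 2)!`.
    have havg := sum_mult_last hinv hzero (k + n + 1)
    rw [← hsum] at havg
    have hk0 : (2 * (k + n + 1 : ℕ) : ℚ) ≠ 0 := by positivity
    refine mul_left_cancel₀ hk0 ?_
    rw [← havg, Nat.factorial_succ (n + 1)]
    push_cast
    ring

theorem isInvariant_indicator_isoClass (G : RawGraph n s) :
    IsInvariant ((isoClass G).indicator 1) := by
  classical
  rintro H K ⟨φ⟩
  have : Nonempty (RawGraph.Iso G H) ↔ Nonempty (RawGraph.Iso G K) :=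
    ⟨fun ⟨χ⟩ => ⟨χ.trans φ⟩, fun ⟨χ⟩ => ⟨χ.trans φ.symm⟩⟩
  simp only [Set.indicator_apply, mk_mem_isoClass, this, Pi.one_apply]

theorem isoClass_subset_admissible {G : RawGraph n s} (h : G.IsAdmissible) :
    isoClass G ⊆ admissible n s := by
  rintro _ ⟨H, ⟨φ⟩, rfl⟩
  exact mk_mem_admissible.2 (φ.isAdmissible_iff.1 h)

/-- The finite support of `θ` makes the `finsum` an honest finite sum for any `S`, rather than its
default value. -/
theorem finsum_mem_eq_linearCombination (S : Set (VGraph n s)) (θ : VGraph n s →₀ ℚ) :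
    ∑ᶠ H ∈ S, θ H = Finsupp.linearCombination ℚ (S.indicator 1) θ := by
  classical
  rw [finsum_mem_def, finsum_eq_sum_of_support_subset (s := θ.support),
    Finsupp.linearCombination_apply]
  · refine Finset.sum_congr rfl fun H _ => ?_
    simp [Set.indicator_apply]
  · intro H hH
    rw [Finset.mem_coe, Finsupp.mem_support_iff]
    intro h0
    exact hH (by simp [Set.indicator_apply, h0])

end VGraph

theorem mainTheorem2 (s n k : ℕ) (hn : 1 ≤ n) :
    VGraph.thetaHat s n k ∈ Finsupp.supported ℚ ℚ (VGraph.loopless n k s) ∧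
    (∀ G ∈ VGraph.loopless n k s, 0 < VGraph.thetaHat s n k G) ∧
    (∀ G : RawGraph n s, VGraph.mk G ∈ VGraph.loopless n k s →
      ∑ᶠ H ∈ VGraph.isoClass G, VGraph.thetaHat s n k H = 1 / (G.symmetryFactor : ℚ)) := by
  refine ⟨?_, VGraph.thetaHat_pos s n k hn, fun G hG => ?_⟩
  · rw [Finsupp.mem_supported]
    exact fun H hH => VGraph.thetaHat_mem_loopless s n k H (Finsupp.mem_support_iff.1 hH)
  · obtain ⟨hA, hm⟩ := VGraph.mk_mem_loopless.1 hG
    obtain ⟨n, rfl⟩ := Nat.exists_eq_add_of_le' hn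
    have h₁ := VGraph.linearCombination_thetaHat s n k G.m hm
      (VGraph.isInvariant_indicator_isoClass G)
    have h₂ := VGraph.sum_indicator_isoClass G
    -- The class of `G` consists of admissible graphs only, so restricting its indicator to
    -- admissible graphs changes nothing and both counts agree.
    rw [Set.indicator_indicator,
      Set.inter_eq_right.2 (VGraph.isoClass_subset_admissible hA)] at h₁
    rw [← h₁] at h₂
    rw [VGraph.finsum_mem_eq_linearCombination,
      eq_div_iff (Nat.cast_ne_zero.2 G.symmetryFactor_pos.ne')]
    have h0 : ((n + 1).factorial * G.m.factorial * 2 ^ G.m : ℚ) ≠ 0 := by positivity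
    refine mul_left_cancel₀ h0 ?_
    rw [← mul_assoc, h₂, mul_one]
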